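/- Let $n\ge 1$, let $\mathbb B_n$ and $\mathbb S_n$ be the open unit ball and the unit sphere of $\mathbb C^n$, put $\langle z,w\rangle=\sum_i z_i\bar w_i$, let $du$ be Lebesgue measure on $\mathbb C^n$ normalized by $u(\mathbb B_n)=1$, and let $d\sigma$ be the normalized rotation-invariant measure on $\mathbb S_n$. For $\alpha\in\mathbb R$ and $f=\sum_k a_kz^k$ holomorphic in $\mathbb B_n$ (sum over multi-indices $k\in\mathbb Z_{\ge 0}^n$) put $$\|f\|_\alpha^2=\sum_{k}(n+|k|)^\alpha\frac{(n-1)!\,k!}{(n-1+|k|)!}|a_k|^2\in[0,\infty],$$ and say that $f\in D_\alpha(\mathbb B_n)$ if $\|f\|_\alpha<\infty$. The ball algebra $A(\mathbb B_n)$ consists of the functions that are continuous on the closed unit ball and holomorphic in $\mathbb B_n$. For $f\in A(\mathbb B_n)$ and $1\le p,q\le n$ put $$I_p(f)=\int_{\mathbb B_n}(1-\|z\|^2)\left|\int_{\mathbb S_n}\frac{f(\zeta)\bar\zeta_p}{(1-\langle z,\zeta\rangle)^{n+\alpha/2+1}}\,d\sigma(\zeta)\right|^2du(z),$$ $$I_{p,q}(f)=\int_{\mathbb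 B_n}\left|\int_{\mathbb S_n}\frac{\overline{(z_p\zeta_q-z_q\zeta_p)}\,f(\zeta)}{(1-\langle z,\zeta\rangle)^{n+\alpha/2+1}}\,d\sigma(\zeta)\right|^2du(z),$$ with the principal branch of the power. **Theorem.** Let $\alpha\in\mathbb R$ be such that $n-1+\alpha/2\ge 0$. Then for every $f\in A(\mathbb B_n)$, $f\in D_\alpha(\mathbb B_n)$ if and only if $I_p(f)<\infty$ and $I_{p,q}(f)<\infty$ for all $p,q=1,\dots,n$. Moreover, these integrals give an equivalent norm: there are constants $c,C>0$, depending only on $n$ and $\alpha$, such that for every $f\in A(\mathbb B_n)$ $$c\,\|f\|_\alpha^2\le |f(0)|^2+\sum_{p}I_p(f)+\sum_{p,q}I_{p,q}(f)\le C\,\|f\|_\alpha^2 ,$$ where both sides may be $\infty$. -/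

import Mathlib

open MeasureTheory Metric
open scoped ENNReal NNReal Nat ComplexConjugate

noncomputable section

/-- Complex Euclidean space `ℂⁿ` with the norm `‖z‖² = |z₁|² + ⋯ + |zₙ|²`. -/
abbrev Cn (n : ℕ) : Type := EuclideanSpace ℂ (Fin n)

/-- The open unit ball of `ℂⁿ`. -/
abbrev unitBall (n : ℕ) : Set (Cn n) := ball 0 1

/-- The inner product `⟨z, w⟩ = z₁ w̄₁ + ⋯ + zₙ w̄ₙ`, linear in the first variable
(Mathlib's `inner` is linear in the second one). -/
def herm {n : ℕ} (z w : Cn n) : ℂ := inner ℂ w z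

/-- The volume measure of `ℂⁿ = ℝ²ⁿ`, normalized so that the unit ball has measure `1`. -/
def ballMeasure (n : ℕ) : Measure (Cn n) :=
  (volume (unitBall n))⁻¹ • volume

/-- The normalized rotation-invariant measure on the unit sphere of `ℂⁿ`: the surface measure
given by polar coordinates, divided by its total mass. -/
def sphereMeasure (n : ℕ) : Measure (sphere (0 : Cn n) 1) :=
  ((volume : Measure (Cn n)).toSphere Set.univ)⁻¹ • (volume : Measure (Cn n)).toSphere

/-- The ball algebra: continuous on the closed unit ball, holomorphic in the open one. -/
def InBallAlgebra {n : ℕ} (f : Cn n → ℂ) : Prop :=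
  ContinuousOn f (closedBall 0 1) ∧ DifferentiableOn ℂ f (unitBall n)

/-- `f(z) = ∑ₖ aₖ zᵏ` for every `z` in the unit ball, the sum being over all multi-indices `k`.
Every holomorphic function on the ball has exactly one such family of coefficients. -/
def HasExpansion {n : ℕ} (f : Cn n → ℂ) (a : (Fin n → ℕ) → ℂ) : Prop :=
  ∀ z ∈ unitBall n, HasSum (fun k : Fin n → ℕ => a k * ∏ i, z i ^ k i) (f z)

/-- The weight `(n + |k|)^α (n-1)! k! / (n-1+|k|)!`. -/
def dirichletWeight (n : ℕ) (α : ℝ) (k : Fin n → ℕ) : ℝ :=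
  ((n : ℝ) + ((∑ i, k i : ℕ) : ℝ)) ^ α *
    (((n - 1)! : ℝ) * (∏ i, ((k i)! : ℝ)) / ((n - 1 + ∑ i, k i)! : ℝ))

/-- The squared Dirichlet-type norm `∑ₖ (n + |k|)^α (n-1)! k! / (n-1+|k|)! |aₖ|² ∈ [0, ∞]`
of the function with power series coefficients `a`. -/
def dirichletNormSq (n : ℕ) (α : ℝ) (a : (Fin n → ℕ) → ℂ) : ℝ≥0∞ :=
  ∑' k : Fin n → ℕ, ENNReal.ofReal (dirichletWeight n α k * ‖a k‖ ^ 2)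

/-- The Dirichlet-type space `D_α` of the unit ball. -/
def InDirichletSpace {n : ℕ} (α : ℝ) (f : Cn n → ℂ) : Prop :=
  DifferentiableOn ℂ f (unitBall n) ∧ ∃ a, HasExpansion f a ∧ dirichletNormSq n α a < ∞

/-- `∫_𝕊 f(ζ) ζ̄_p (1 - ⟨z, ζ⟩)^{-(n+α/2+1)} dσ(ζ)`, with the principal branch of the power. -/
def cauchyTerm {n : ℕ} (α : ℝ) (f : Cn n → ℂ) (p : Fin n) (z : Cn n) : ℂ :=
  ∫ ζ : sphere (0 : Cn n) 1,
    f ζ * conj ((ζ : Cn n) p) / (1 - herm z ζ) ^ (((n : ℝ) + α / 2 + 1 : ℝ) : ℂ)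
      ∂(sphereMeasure n)

/-- `∫_𝕊 conj (z_p ζ_q - z_q ζ_p) f(ζ) (1 - ⟨z, ζ⟩)^{-(n+α/2+1)} dσ(ζ)`. -/
def antisymTerm {n : ℕ} (α : ℝ) (f : Cn n → ℂ) (p q : Fin n) (z : Cn n) : ℂ :=
  ∫ ζ : sphere (0 : Cn n) 1,
    conj (z p * (ζ : Cn n) q - z q * (ζ : Cn n) p) * f ζ /
        (1 - herm z ζ) ^ (((n : ℝ) + α / 2 + 1 : ℝ) : ℂ)
      ∂(sphereMeasure n)

/-- `∫_𝔹 (1 - ‖z‖²) |cauchyTerm|² du(z)`, a number in `[0, ∞]`. -/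
def cauchyIntegral {n : ℕ} (α : ℝ) (f : Cn n → ℂ) (p : Fin n) : ℝ≥0∞ :=
  ∫⁻ z in unitBall n, ENNReal.ofReal ((1 - ‖z‖ ^ 2) * ‖cauchyTerm α f p z‖ ^ 2)
    ∂(ballMeasure n)

/-- `∫_𝔹 |antisymTerm|² du(z)`, a number in `[0, ∞]`. -/
def antisymIntegral {n : ℕ} (α : ℝ) (f : Cn n → ℂ) (p q : Fin n) : ℝ≥0∞ :=
  ∫⁻ z in unitBall n, ENNReal.ofReal (‖antisymTerm α f p q z‖ ^ 2) ∂(ballMeasure n)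

end

open Filter Topology

/-! Put β = n + α/2 + 1, w_l = `sphereWeight l`. The kernel (1 - ⟨z, ζ⟩)^{-β} is the sum of
(β)_{|k|}/k! · z^k conj(ζ^k), and the integral of f conj(ζ^l) over the sphere is a_l w_l.
Integrating f conj(ζ_p) against the kernel therefore turns a_l into κ(|l|) a_l ∂_p z^l, where κ(M) =
(β)_{M-1} (n-1)!/(n-1+M)! depends on the degree only. So `cauchyTerm` is ∂_p g for the single
function g = ∑ κ(|l|) a_l z^l, and `antisymTerm` is the tangential derivative conj(z_p) ∂_q g -
conj(z_q) ∂_p g (`hasSum_cauchyTerm`, `hasSum_antisymTerm`).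

The functions ∂_p z^l, for fixed p and varying l with l_p ≠ 0, are orthogonal on spheres, with
squared norm l_p (n-1+|l|) w_l on the unit sphere. For p ≠ q the tangential derivatives of the
monomials are pairwise orthogonal too, with squared norm (l_p + l_q) w_l. Parseval on each sphere
and integration in the radius (`lintegral_ball_norm_sq_of_hasSum_orthogonal`) give I_p = ∑ κ(|l|)²
l_p n/(n+|l|) w_l |a_l|², and I_{p,q} = I_p + I_q when p ≠ q. The tangential integrals are thus
controlled by the I_p.

Summing over p leaves the weight κ(M)² M n/(n+M) in degree M = |l|. Euler's limit for the Gamma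
function shows that κ(M) is comparable to M^{α/2}, so this weight is comparable to (n+M)^α for M ≥ 1
(`exists_kernelMultiplier_bounds`); |f(0)|² supplies degree 0. -/

/-! ### Orthogonality of monomials on the sphere, by Gaussian integrals. -/

/-- The monomial `z^k`. -/
def mono {n : ℕ} (k : Fin n → ℕ) (z : Cn n) : ℂ := ∏ i, z i ^ k i

/-- The squared norm of the monomial `ζ^k` in `L²` of the sphere. -/
noncomputable def sphereWeight {n : ℕ} (k : Fin n → ℕ) : ℝ :=
  ((n - 1)! : ℝ) * (∏ i, ((k i)! : ℝ)) / ((n - 1 + ∑ i, k i)! : ℝ)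

lemma sphereWeight_pos {n : ℕ} (k : Fin n → ℕ) : 0 < sphereWeight k := by
  unfold sphereWeight
  have : 0 < ∏ i, ((k i)! : ℝ) := Finset.prod_pos fun i _ => by positivity
  positivity

@[fun_prop]
lemma continuous_mono {n : ℕ} (k : Fin n → ℕ) : Continuous (mono k) := by
  unfold mono; fun_prop

lemma mono_smul {n : ℕ} (k : Fin n → ℕ) (r : ℝ) (z : Cn n) :
    mono k (r • z) = (r : ℂ) ^ (∑ i, k i) * mono k z := by
  simp [mono, mul_pow, Finset.prod_mul_distrib, Finset.prod_pow_eq_pow_sum]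

/-- For a = b this is a Gamma integral. For a ≠ b the rotation by the angle π/(a-b) preserves the
measure and multiplies the integrand by -1. -/
lemma integral_pow_conj_pow_gaussian (a b : ℕ) :
    ∫ z : ℂ, z ^ a * conj z ^ b * (Real.exp (-‖z‖ ^ 2) : ℂ) =
      if a = b then ((Real.pi * a ! : ℝ) : ℂ) else 0 := by
  split_ifs with h
  · subst h
    have := Complex.integral_rpow_mul_exp_neg_rpow (p := 2) (q := 2 * a) (by norm_num) (by
      have : (0 : ℝ) ≤ a := by positivity
      linarith)
    rw [show ((2 * (a : ℝ)) + 2) / 2 = a + 1 by ring, Real.Gamma_nat_eq_factorial] at this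
    rw [show Real.pi * (a ! : ℝ) = 2 * Real.pi / 2 * (a ! : ℝ) by ring, ← this, ← integral_complex_ofReal]
    refine integral_congr_ae (.of_forall fun z => ?_)
    simp only
    rw [← mul_pow, Complex.mul_conj, Complex.normSq_eq_norm_sq]
    have : ‖z‖ ^ (2 * (a : ℝ)) = (‖z‖ ^ 2) ^ a := by
      rw [← pow_mul, ← Real.rpow_natCast]; norm_num
    rw [this]
    norm_num
  · set I := ∫ z : ℂ, z ^ a * conj z ^ b * (Real.exp (-‖z‖ ^ 2) : ℂ) with hI
    have hab : ((a : ℂ) - b) ≠ 0 := sub_ne_zero.2 (by exact_mod_cast h)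
    have key : ∀ c : Circle, I = (c : ℂ) ^ a * conj (c : ℂ) ^ b * I := by
      intro c
      have h1 := (rotation c).measurePreserving.integral_comp
        (rotation c).toHomeomorph.measurableEmbedding
        (fun z : ℂ => z ^ a * conj z ^ b * (Real.exp (-‖z‖ ^ 2) : ℂ))
      rw [← hI] at h1
      conv_lhs => rw [← h1]
      rw [hI, ← integral_const_mul]
      refine integral_congr_ae (.of_forall fun z => ?_)
      simp only [(rotation c).norm_map]
      simp [mul_pow]
      ring
    have h2 := key (Circle.exp (Real.pi / ((a : ℝ) - b)))
    have h3 : ((Circle.exp (Real.pi / ((a : ℝ) - b)) : Circle) : ℂ) ^ a *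
        conj ((Circle.exp (Real.pi / ((a : ℝ) - b)) : Circle) : ℂ) ^ b = -1 := by
      rw [Circle.coe_exp, ← Complex.exp_conj, ← Complex.exp_nat_mul, ← Complex.exp_nat_mul,
        ← Complex.exp_add, ← Complex.exp_pi_mul_I]
      congr 1
      simp
      field_simp
      ring
    rw [h3] at h2
    have : I + I = 0 := by linear_combination h2
    simpa using this

/-- Uniqueness of Haar measure. The constant may stay unknown: `integral_mono_mul_conj_mono`
recovers the normalization from k = l = 0. -/
lemma exists_volume_eq_smul_map (n : ℕ) : ∃ c : ℝ≥0∞, (volume : Measure (Cn n)) =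
    c • (volume : Measure (Fin n → ℂ)).map (EuclideanSpace.equiv (Fin n) ℂ).symm := by
  have : ((volume : Measure (Fin n → ℂ)).map
      (EuclideanSpace.equiv (Fin n) ℂ).symm).IsAddHaarMeasure :=
    (EuclideanSpace.equiv (Fin n) ℂ).symm.isAddHaarMeasure_map _
  exact ⟨_, Measure.isAddLeftInvariant_eq_smul _ _⟩

lemma integral_mono_gaussian (n : ℕ) : ∃ c : ℝ, ∀ k l : Fin n → ℕ,
    ∫ z : Cn n, mono k z * conj (mono l z) * (Real.exp (-‖z‖ ^ 2) : ℂ) =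
      if k = l then ((c * ∏ i, ((k i)! : ℝ) : ℝ) : ℂ) else 0 := by
  obtain ⟨c, hc⟩ := exists_volume_eq_smul_map n
  refine ⟨c.toReal * Real.pi ^ n, fun k l => ?_⟩
  rw [hc, integral_smul_measure]
  erw [(EuclideanSpace.equiv (Fin n) ℂ).symm.toHomeomorph.measurableEmbedding.integral_map]
  have : ∀ x : Fin n → ℂ, mono k ((EuclideanSpace.equiv (Fin n) ℂ).symm x) *
      conj (mono l ((EuclideanSpace.equiv (Fin n) ℂ).symm x)) *
      (Real.exp (-‖(EuclideanSpace.equiv (Fin n) ℂ).symm x‖ ^ 2) : ℂ) =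
      ∏ i, (x i ^ k i * conj (x i) ^ l i * (Real.exp (-‖x i‖ ^ 2) : ℂ)) := by
    intro x
    simp only [mono, Finset.prod_mul_distrib, map_prod, map_pow, EuclideanSpace.norm_sq_eq,
      ← Finset.sum_neg_distrib, Real.exp_sum, Complex.ofReal_prod]
    simp
  erw [integral_congr_ae (.of_forall this)]
  rw [integral_fintype_prod_volume_eq_prod (𝕜 := ℂ)
    (fun (i : Fin n) (z : ℂ) => z ^ k i * conj z ^ l i * (Real.exp (-‖z‖ ^ 2) : ℂ))]
  simp only [integral_pow_conj_pow_gaussian]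
  split_ifs with h
  · subst h
    simp [Finset.prod_mul_distrib, mul_assoc]
  · obtain ⟨i, hi⟩ := Function.ne_iff.1 h
    rw [Finset.prod_eq_zero (Finset.mem_univ i) (by simp [hi])]
    simp

lemma integral_polar {n : ℕ} (hn : 1 ≤ n) (F : Cn n → ℂ) :
    ∫ z, F z = ∫ x : sphere (0 : Cn n) 1 × Set.Ioi (0 : ℝ), F ((x.2 : ℝ) • (x.1 : Cn n))
      ∂((volume : Measure (Cn n)).toSphere.prod (Measure.volumeIoiPow (2 * n - 1))) := by
  have hd : Module.finrank ℝ (Cn n) = 2 * n := by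
    rw [finrank_real_of_complex]; simp
  have : Nontrivial (Cn n) := by
    have : 0 < Module.finrank ℝ (Cn n) := by omega
    exact Module.nontrivial_of_finrank_pos this
  have h := (volume : Measure (Cn n)).measurePreserving_homeomorphUnitSphereProd
  rw [hd] at h
  have h1 : ∫ z, F z = ∫ z in ({0}ᶜ : Set (Cn n)), F z := by
    rw [restrict_compl_singleton]
  rw [h1, ← integral_subtype_comap (measurableSet_singleton _).compl]
  rw [← h.integral_comp (Homeomorph.measurableEmbedding _)]
  refine integral_congr_ae (.of_forall fun z => ?_)
  simp only [homeomorphUnitSphereProd_apply_fst_coe, homeomorphUnitSphereProd_apply_snd_coe]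
  rw [smul_smul, mul_inv_cancel₀ (norm_ne_zero_iff.2 z.2), one_smul]

lemma integral_volumeIoiPow (m : ℕ) (f : ℝ → ℂ) :
    ∫ r : Set.Ioi (0 : ℝ), f r ∂(Measure.volumeIoiPow m) =
      ∫ r in Set.Ioi (0 : ℝ), (r : ℂ) ^ m * f r := by
  unfold Measure.volumeIoiPow
  rw [integral_withDensity_eq_integral_toReal_smul₀ (by fun_prop) (by simp)]
  rw [← integral_subtype_comap measurableSet_Ioi]
  refine integral_congr_ae (.of_forall fun r => ?_)
  have : (0 : ℝ) < r := r.2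
  simp [ENNReal.toReal_ofReal, this.le]

lemma integral_pow_exp (n d : ℕ) (hn : 1 ≤ n) :
    ∫ r in Set.Ioi (0 : ℝ), (r : ℂ) ^ (2 * n - 1) * ((r : ℂ) ^ d * (Real.exp (-r ^ 2) : ℂ)) =
      ((Real.Gamma (((2 * n + d : ℕ) : ℝ) / 2) / 2 : ℝ) : ℂ) := by
  have h := integral_rpow_mul_exp_neg_rpow (p := 2) (q := (2 * n - 1 + d : ℕ)) (by norm_num) (by
    have : (0 : ℝ) ≤ (2 * n - 1 + d : ℕ) := by positivity
    linarith)
  have e : ((2 * n - 1 + d : ℕ) : ℝ) + 1 = ((2 * n + d : ℕ) : ℝ) := by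
    rw [← Nat.cast_add_one]; congr 1; omega
  rw [e] at h
  rw [show Real.Gamma (((2 * n + d : ℕ) : ℝ) / 2) / 2 =
    1 / 2 * Real.Gamma (((2 * n + d : ℕ) : ℝ) / 2) by ring, ← h, ← integral_complex_ofReal]
  refine integral_congr_ae (.of_forall fun r => ?_)
  simp only
  rw [Real.rpow_natCast, ← mul_assoc, ← pow_add]
  norm_num

/-- In polar coordinates the Gaussian integral over ℂⁿ is the sphere integral times a nonzero radial
factor, which equals (n-1+|k|)!/2 when k = l; one divides by it. -/
lemma integral_mono_toSphere {n : ℕ} (hn : 1 ≤ n) : ∃ c : ℝ, ∀ k l : Fin n → ℕ,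
    ∫ ζ : sphere (0 : Cn n) 1, mono k ζ * conj (mono l ζ) ∂(volume : Measure (Cn n)).toSphere =
      if k = l then ((c * ((∏ i, ((k i)! : ℝ)) / ((n - 1 + ∑ i, k i)! : ℝ)) : ℝ) : ℂ) else 0 := by
  obtain ⟨c, hc⟩ := integral_mono_gaussian n
  refine ⟨2 * c, fun k l => ?_⟩
  have h := hc k l
  rw [integral_polar hn] at h
  have e : ∀ x : sphere (0 : Cn n) 1 × Set.Ioi (0 : ℝ),
      mono k ((x.2 : ℝ) • (x.1 : Cn n)) * conj (mono l ((x.2 : ℝ) • (x.1 : Cn n))) *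
        (Real.exp (-‖(x.2 : ℝ) • (x.1 : Cn n)‖ ^ 2) : ℂ) =
      (mono k (x.1 : Cn n) * conj (mono l (x.1 : Cn n))) *
        ((((x.2 : ℝ)) : ℂ) ^ (∑ i, k i + ∑ i, l i) * (Real.exp (-(x.2 : ℝ) ^ 2) : ℂ)) := by
    rintro ⟨ζ, r⟩
    have hζ : ‖(ζ : Cn n)‖ = 1 := by simp
    simp only [mono_smul, norm_smul, hζ, map_mul, map_pow, Complex.conj_ofReal, mul_one, pow_add,
      Real.norm_eq_abs, sq_abs]
    ring
  rw [integral_congr_ae (.of_forall e)] at h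
  rw [integral_prod_mul (fun ζ : sphere (0 : Cn n) 1 => mono k (ζ : Cn n) * conj (mono l (ζ : Cn n)))
    (fun r : Set.Ioi (0 : ℝ) => ((((r : ℝ)) : ℂ) ^ (∑ i, k i + ∑ i, l i) *
      (Real.exp (-(r : ℝ) ^ 2) : ℂ))),
    integral_volumeIoiPow _ (fun r : ℝ => ((r : ℂ)) ^ (∑ i, k i + ∑ i, l i) *
      (Real.exp (-r ^ 2) : ℂ)), integral_pow_exp n _ hn] at h
  have hG : 0 < Real.Gamma (((2 * n + (∑ i, k i + ∑ i, l i) : ℕ) : ℝ) / 2) :=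
    Real.Gamma_pos_of_pos (by positivity)
  have hG' : ((Real.Gamma (((2 * n + (∑ i, k i + ∑ i, l i) : ℕ) : ℝ) / 2) / 2 : ℝ) : ℂ) ≠ 0 := by
    exact_mod_cast (by positivity)
  rw [← eq_div_iff hG'] at h
  rw [h]
  split_ifs with hkl
  · subst hkl
    have : ((2 * n + (∑ i, k i + ∑ i, k i) : ℕ) : ℝ) / 2 = ((n - 1 + ∑ i, k i : ℕ) : ℝ) + 1 := by
      rw [← Nat.cast_add_one, show n - 1 + ∑ i, k i + 1 = n + ∑ i, k i by omega]
      push_cast; ring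
    rw [this, Real.Gamma_nat_eq_factorial, ← Complex.ofReal_div]
    congr 1
    field_simp
  · simp

lemma nontrivial_Cn {n : ℕ} (hn : 1 ≤ n) : Nontrivial (Cn n) := by
  have hd : Module.finrank ℝ (Cn n) = 2 * n := by
    rw [finrank_real_of_complex]; simp
  exact Module.nontrivial_of_finrank_pos (R := ℝ) (by omega)

lemma isProbabilityMeasure_sphereMeasure {n : ℕ} (hn : 1 ≤ n) :
    IsProbabilityMeasure (sphereMeasure n) := by
  have := nontrivial_Cn hn
  constructor
  simp only [sphereMeasure, Measure.smul_apply, smul_eq_mul]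
  exact ENNReal.inv_mul_cancel (Measure.measure_univ_ne_zero.2 (Measure.toSphere_ne_zero (volume : Measure (Cn n))))
    (measure_ne_top _ _)

theorem integral_mono_mul_conj_mono {n : ℕ} (hn : 1 ≤ n) (k l : Fin n → ℕ) :
    ∫ ζ : sphere (0 : Cn n) 1, mono k ζ * conj (mono l ζ) ∂(sphereMeasure n) =
      if k = l then (sphereWeight k : ℂ) else 0 := by
  obtain ⟨c, hc⟩ := integral_mono_toSphere hn
  have hp := isProbabilityMeasure_sphereMeasure hn
  unfold sphereMeasure at hp ⊢
  set t := ((volume : Measure (Cn n)).toSphere Set.univ)⁻¹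
  -- The case k = l = 0, where a probability measure must give 1, determines the unknown constant.
  have h0 : t.toReal * (c * (1 / ((n - 1)! : ℝ))) = 1 := by
    have h1 : ∫ ζ : sphere (0 : Cn n) 1, mono 0 (ζ : Cn n) * conj (mono 0 (ζ : Cn n))
      ∂(t • (volume : Measure (Cn n)).toSphere) = 1 := by
      simp only [mono, Pi.zero_apply, pow_zero, Finset.prod_const_one, map_one, mul_one,
        integral_const]
      simp
    rw [integral_smul_measure, hc 0 0] at h1
    simp at h1
    have h2 : ((t.toReal * (c * (1 / ((n - 1)! : ℝ))) : ℝ) : ℂ) = 1 := by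
      rw [← h1]; simp
    exact_mod_cast h2
  rw [integral_smul_measure, hc]
  split_ifs with h
  · rw [Complex.real_smul, ← Complex.ofReal_mul]
    congr 1
    unfold sphereWeight
    have hf : ((n - 1)! : ℝ) ≠ 0 := by positivity
    field_simp at h0 ⊢
    linear_combination h0
  · simp

/-! ### Polar coordinates for the normalized measures. -/

lemma finrank_real_Cn (n : ℕ) : Module.finrank ℝ (Cn n) = 2 * n := by
  rw [finrank_real_of_complex]; simp

lemma lintegral_toSphere_eq {n : ℕ} (hn : 1 ≤ n) (F : sphere (0 : Cn n) 1 → ℝ≥0∞) :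
    ∫⁻ ζ, F ζ ∂(volume : Measure (Cn n)).toSphere =
      (volume : Measure (Cn n)).toSphere Set.univ * ∫⁻ ζ, F ζ ∂(sphereMeasure n) := by
  have := nontrivial_Cn hn
  unfold sphereMeasure
  rw [lintegral_smul_measure, smul_eq_mul, ← mul_assoc, ENNReal.mul_inv_cancel, one_mul]
  · exact Measure.measure_univ_ne_zero.2 (Measure.toSphere_ne_zero (volume : Measure (Cn n)))
  · exact measure_ne_top _ _

lemma lintegral_volumeIoiPow (m : ℕ) (f : ℝ → ℝ≥0∞) :
    ∫⁻ r : Set.Ioi (0 : ℝ), f r ∂(Measure.volumeIoiPow m) =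
      ∫⁻ r in Set.Ioi (0 : ℝ), ENNReal.ofReal (r ^ m) * f r := by
  unfold Measure.volumeIoiPow
  rw [lintegral_withDensity_eq_lintegral_mul_non_measurable _ (by fun_prop) (by simp),
    ← lintegral_subtype_comap measurableSet_Ioi]
  rfl

/-- Polar coordinates in the unit ball, for the normalized measures. -/
theorem lintegral_ballMeasure_polar {n : ℕ} (hn : 1 ≤ n) {F : Cn n → ℝ≥0∞} (hF : Measurable F) :
    ∫⁻ z in unitBall n, F z ∂(ballMeasure n) =
      ∫⁻ r in Set.Ioo (0 : ℝ) 1, ENNReal.ofReal (2 * n * r ^ (2 * n - 1)) *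
        ∫⁻ ζ : sphere (0 : Cn n) 1, F (r • (ζ : Cn n)) ∂(sphereMeasure n) := by
  have := nontrivial_Cn hn
  have hd := finrank_real_Cn n
  have h := (volume : Measure (Cn n)).measurePreserving_homeomorphUnitSphereProd
  rw [hd] at h
  have h1 : ∫⁻ z in unitBall n, F z = ∫⁻ z in ({0}ᶜ : Set (Cn n)), (unitBall n).indicator F z := by
    rw [restrict_compl_singleton, lintegral_indicator measurableSet_ball]
  have h2 : ∫⁻ z in unitBall n, F z =
      ∫⁻ x : sphere (0 : Cn n) 1 × Set.Ioi (0 : ℝ),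
        (unitBall n).indicator F ((x.2 : ℝ) • (x.1 : Cn n))
        ∂((volume : Measure (Cn n)).toSphere.prod (Measure.volumeIoiPow (2 * n - 1))) := by
    rw [h1, ← lintegral_subtype_comap (measurableSet_singleton _).compl]
    rw [← h.lintegral_comp_emb (Homeomorph.measurableEmbedding _)]
    refine lintegral_congr fun z => ?_
    simp only [homeomorphUnitSphereProd_apply_fst_coe, homeomorphUnitSphereProd_apply_snd_coe]
    rw [smul_smul, mul_inv_cancel₀ (norm_ne_zero_iff.2 z.2), one_smul]
  have hind : Measurable ((unitBall n).indicator F) := hF.indicator measurableSet_ball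
  have hm : Measurable fun x : sphere (0 : Cn n) 1 × Set.Ioi (0 : ℝ) =>
      (unitBall n).indicator F ((x.2 : ℝ) • (x.1 : Cn n)) := by
    refine hind.comp ?_
    exact Continuous.measurable (by fun_prop)
  rw [lintegral_prod_symm _ hm.aemeasurable] at h2
  simp_rw [lintegral_toSphere_eq hn] at h2
  rw [lintegral_volumeIoiPow _ (fun r : ℝ => (volume : Measure (Cn n)).toSphere Set.univ *
    ∫⁻ ζ : sphere (0 : Cn n) 1, (unitBall n).indicator F (r • (ζ : Cn n)) ∂(sphereMeasure n)),
    Measure.toSphere_apply_univ, hd] at h2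
  have hB0 : volume (unitBall n) ≠ 0 := (measure_ball_pos _ _ one_pos).ne'
  have hBt : volume (unitBall n) ≠ ∞ := measure_ball_lt_top.ne
  unfold ballMeasure
  rw [Measure.restrict_smul, lintegral_smul_measure, h2, smul_eq_mul,
    ← lintegral_const_mul' _ _ (ENNReal.inv_ne_top.2 hB0),
    ← lintegral_indicator measurableSet_Ioi, ← lintegral_indicator measurableSet_Ioo]
  refine lintegral_congr fun r => ?_
  by_cases hr0 : 0 < r
  · rw [Set.indicator_of_mem (Set.mem_Ioi.2 hr0)]
    by_cases hr1 : r < 1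
    · rw [Set.indicator_of_mem (Set.mem_Ioo.2 ⟨hr0, hr1⟩)]
      have : ∀ ζ : sphere (0 : Cn n) 1,
          (unitBall n).indicator F (r • (ζ : Cn n)) = F (r • (ζ : Cn n)) := fun ζ =>
        Set.indicator_of_mem (by simp [norm_smul, abs_of_pos hr0, hr1]) _
      simp_rw [this]
      rw [ENNReal.ofReal_mul (by positivity)]
      have e : ENNReal.ofReal (2 * (n : ℝ)) = ((2 * n : ℕ) : ℝ≥0∞) := by
        rw [← ENNReal.ofReal_natCast]; push_cast; rfl
      rw [e]
      calc _ = (volume (unitBall n))⁻¹ * volume (unitBall n) *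
            (((2 * n : ℕ) : ℝ≥0∞) * ENNReal.ofReal (r ^ (2 * n - 1)) *
            ∫⁻ ζ : sphere (0 : Cn n) 1, F (r • (ζ : Cn n)) ∂(sphereMeasure n)) := by ring
        _ = _ := by rw [ENNReal.inv_mul_cancel hB0 hBt, one_mul]
    · rw [Set.indicator_of_notMem (by simp [hr1])]
      have : ∀ ζ : sphere (0 : Cn n) 1, (unitBall n).indicator F (r • (ζ : Cn n)) = 0 := fun ζ =>
        Set.indicator_of_notMem (by simpa [norm_smul, abs_of_pos hr0] using hr1) _
      simp [this]
  · rw [Set.indicator_of_notMem (by simpa using hr0), Set.indicator_of_notMem (by simp [hr0])]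

/-! ### Termwise integration and Parseval's identity. -/

lemma norm_le_of_hasSum {ι : Type*} {v : ι → ℂ} {w : ℂ} {C : ℝ} (h : HasSum v w)
    (hC : ∀ s : Finset ι, ∑ i ∈ s, ‖v i‖ ≤ C) : ‖w‖ ≤ C :=
  le_of_tendsto h.norm (.of_forall fun s => (norm_sum_le _ _).trans (hC s))

section TermwiseIntegration

variable {X ι : Type*} [MeasurableSpace X] [Countable ι] {μ : Measure X} [IsFiniteMeasure μ]
  {u : ι → X → ℂ} {F : X → ℂ} {C : ℝ}

lemma measurable_of_hasSum (hu : ∀ i, Measurable (u i)) (hF : ∀ x, HasSum (fun i => u i x) (F x)) :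
    Measurable F :=
  measurable_of_tendsto_metrizable' (atTop : Filter (Finset ι))
    (f := fun s x => ∑ i ∈ s, u i x) (fun s => by fun_prop) (tendsto_pi_nhds.2 hF)

/-- The uniform bound C on finite sums of norms bounds the sums of the L¹ norms by C μ(X), so Fubini
for series applies. -/
lemma hasSum_integral_of_sum_norm_le (hu : ∀ i, Measurable (u i))
    (hC : ∀ x, ∀ s : Finset ι, ∑ i ∈ s, ‖u i x‖ ≤ C)
    (hF : ∀ x, HasSum (fun i => u i x) (F x)) :
    HasSum (fun i => ∫ x, u i x ∂μ) (∫ x, F x ∂μ) := by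
  have hint : ∀ i, Integrable (u i) μ := fun i =>
    Integrable.of_bound (hu i).aestronglyMeasurable C (.of_forall fun x => by simpa using hC x {i})
  have h := hasSum_integral_of_summable_integral_norm (μ := μ) (F := u) hint ?_
  · simpa only [(hF _).tsum_eq] using h
  · refine summable_of_sum_le (c := C * μ.real Set.univ)
      (fun i => integral_nonneg fun x => norm_nonneg _) fun s => ?_
    rw [← integral_finsetSum _ fun i _ => (hint i).norm]
    refine (integral_mono (integrable_finsetSum _ fun i _ => (hint i).norm)
      (integrable_const C) fun x => hC x s).trans ?_
    simp [mul_comm]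

/-- Parseval's identity for a series of pairwise orthogonal functions converging absolutely and
boundedly. -/
theorem lintegral_norm_sq_of_hasSum_orthogonal (hu : ∀ i, Measurable (u i))
    (hC : ∀ x, ∀ s : Finset ι, ∑ i ∈ s, ‖u i x‖ ≤ C)
    (hF : ∀ x, HasSum (fun i => u i x) (F x))
    (ho : ∀ i j, i ≠ j → ∫ x, u i x * conj (u j x) ∂μ = 0) :
    ∫⁻ x, ENNReal.ofReal (‖F x‖ ^ 2) ∂μ = ∑' i, ENNReal.ofReal (∫ x, ‖u i x‖ ^ 2 ∂μ) := by
  have hFm := measurable_of_hasSum hu hF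
  have hFC : ∀ x, ‖F x‖ ≤ C := fun x => norm_le_of_hasSum (hF x) (hC x)
  have huC : ∀ i x, ‖u i x‖ ≤ C := fun i x => by simpa using hC x {i}
  have hsq : ∀ z : ℂ, z * conj z = ((‖z‖ ^ 2 : ℝ) : ℂ) := fun z => by
    rw [Complex.mul_conj, Complex.normSq_eq_norm_sq]
  -- F is expanded twice: once against a fixed conj(u_j), where orthogonality leaves one term, and
  -- then in the conjugated factor of F · conj F.
  have h1 : ∀ j, ∫ x, F x * conj (u j x) ∂μ = ((∫ x, ‖u j x‖ ^ 2 ∂μ : ℝ) : ℂ) := by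
    intro j
    have hj := hasSum_integral_of_sum_norm_le (μ := μ) (u := fun i x => u i x * conj (u j x))
      (F := fun x => F x * conj (u j x)) (C := C * C) (fun i => by
        have := hu i; have := hu j; fun_prop) (fun x s => by
        simp only [norm_mul, RCLike.norm_conj, ← Finset.sum_mul]
        exact mul_le_mul (hC x s) (huC j x) (norm_nonneg _)
          ((norm_nonneg _).trans (hFC x))) (fun x => (hF x).mul_right _)
    rw [hj.unique (hasSum_single j fun i hi => ho i j hi), ← integral_complex_ofReal]
    simp only [hsq]
  have h2 := hasSum_integral_of_sum_norm_le (μ := μ) (u := fun j x => F x * conj (u j x))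
      (F := fun x => F x * conj (F x)) (C := C * C) (fun i => by
        have := hu i; fun_prop) (fun x s => by
        simp only [norm_mul, RCLike.norm_conj, ← Finset.mul_sum]
        exact mul_le_mul (hFC x) (hC x s) (Finset.sum_nonneg fun i _ => norm_nonneg _)
          ((norm_nonneg _).trans (hFC x)))
      (fun x => (((hF x).star)).mul_left _)
  simp only [h1, hsq] at h2
  rw [integral_complex_ofReal] at h2
  have h3 : HasSum (fun i => ∫ x, ‖u i x‖ ^ 2 ∂μ) (∫ x, ‖F x‖ ^ 2 ∂μ) := by
    exact_mod_cast h2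
  rw [← ofReal_integral_eq_lintegral_ofReal, ← h3.tsum_eq, ENNReal.ofReal_tsum_of_nonneg
    (fun i => integral_nonneg fun x => by positivity) h3.summable]
  · refine Integrable.of_bound (by fun_prop) (C ^ 2) (.of_forall fun x => ?_)
    simpa using pow_le_pow_left₀ (norm_nonneg _) (hFC x) 2
  · exact .of_forall fun x => by positivity

end TermwiseIntegration

/-! ### Power series in a ball: bounds, coefficients and uniqueness. -/

lemma norm_mono {n : ℕ} (k : Fin n → ℕ) (z : Cn n) : ‖mono k z‖ = ∏ i, ‖z i‖ ^ k i := by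
  simp [mono, norm_prod]

/-- A power series that converges in a ball is absolutely bounded on smaller closed balls. -/
theorem exists_sum_norm_le_of_summable {n : ℕ} {a : (Fin n → ℕ) → ℂ} {r R : ℝ} (hr : r < R)
    (h : ∀ z ∈ ball (0 : Cn n) R, Summable fun k => a k * mono k z) :
    ∃ C, ∀ z : Cn n, ‖z‖ ≤ r → ∀ s : Finset (Fin n → ℕ), ∑ k ∈ s, ‖a k * mono k z‖ ≤ C := by
  suffices H : ∃ C, ∀ z ∈ closedBall (0 : Cn n) r, ∀ s : Finset (Fin n → ℕ),
      ∑ k ∈ s, ‖a k * mono k z‖ ≤ C by simpa using H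
  refine (isCompact_closedBall (0 : Cn n) r).induction_on
    (p := fun S => ∃ C, ∀ z ∈ S, ∀ s : Finset (Fin n → ℕ), ∑ k ∈ s, ‖a k * mono k z‖ ≤ C)
    ⟨0, by simp⟩ (fun s t hst ⟨C, hC⟩ => ⟨C, fun z hz => hC z (hst hz)⟩)
    (fun s t ⟨C, hC⟩ ⟨D, hD⟩ => ⟨max C D, ?_⟩) fun x hx => ?_
  · rintro z (hz | hz) s
    · exact (hC z hz s).trans (le_max_left _ _)
    · exact (hD z hz s).trans (le_max_right _ _)
  -- Absolute convergence at the point with coordinates |x_i| + ε dominates the series on a polydisc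
  -- that is a neighbourhood of x; compactness of the closed ball then makes the bound uniform.
  · let y : ℝ → Cn n := fun ε => WithLp.toLp 2 fun i => ((‖x i‖ + ε : ℝ) : ℂ)
    have hy : Continuous y := by fun_prop
    have hy0 : ‖y 0‖ < R := by
      have : ‖y 0‖ = ‖x‖ := by simp [y, EuclideanSpace.norm_eq]
      rw [this]
      exact (mem_closedBall_zero_iff.1 hx).trans_lt hr
    obtain ⟨ε, hε0, hε⟩ : ∃ ε > 0, ‖y ε‖ < R := by
      have h1 : ∀ᶠ ε in 𝓝[>] (0 : ℝ), ‖y ε‖ < R :=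
        (hy.norm.tendsto 0).eventually_lt_const hy0 |>.filter_mono nhdsWithin_le_nhds
      obtain ⟨ε, h1, h2⟩ := (h1.and self_mem_nhdsWithin).exists
      exact ⟨ε, h2, h1⟩
    have hs := (h (y ε) (by simpa using hε)).norm
    refine ⟨{z | ∀ i, ‖z i‖ < ‖x i‖ + ε}, mem_nhdsWithin_of_mem_nhds ?_,
      ∑' k, ‖a k * mono k (y ε)‖, fun z hz s => ?_⟩
    · refine IsOpen.mem_nhds ?_ (by simp [hε0])
      simp only [Set.ofPred_forall]
      exact isOpen_iInter_of_finite fun i => isOpen_lt (by fun_prop) (by fun_prop)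
    · refine (Finset.sum_le_sum fun k _ => ?_).trans (hs.sum_le_tsum s fun k _ => norm_nonneg _)
      simp only [norm_mul, norm_mono]
      gcongr with i
      have : 0 ≤ ‖x i‖ + ε := by positivity
      simpa [y, abs_of_nonneg this, ← Complex.ofReal_add] using (hz i).le

theorem integral_mul_conj_mono_of_hasSum {n : ℕ} (hn : 1 ≤ n) {a : (Fin n → ℕ) → ℂ}
    {f : Cn n → ℂ} {r R : ℝ} (hr0 : 0 ≤ r) (hr : r < R)
    (h : ∀ z ∈ ball (0 : Cn n) R, HasSum (fun k => a k * mono k z) (f z)) (l : Fin n → ℕ) :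
    ∫ ζ : sphere (0 : Cn n) 1, f (r • (ζ : Cn n)) * conj (mono l ζ) ∂(sphereMeasure n) =
      a l * r ^ (∑ i, l i) * sphereWeight l := by
  have := isProbabilityMeasure_sphereMeasure hn
  obtain ⟨C, hC⟩ := exists_sum_norm_le_of_summable hr fun z hz => (h z hz).summable
  have hC0 : 0 ≤ C := by simpa using hC 0 (by simpa using hr0) ∅
  obtain ⟨D, hD⟩ : ∃ D, ∀ ζ : sphere (0 : Cn n) 1, ‖mono l (ζ : Cn n)‖ ≤ D := by
    obtain ⟨D, hD⟩ := isCompact_univ.exists_bound_of_continuousOn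
      (f := fun ζ : sphere (0 : Cn n) 1 => mono l (ζ : Cn n)) (by fun_prop)
    exact ⟨D, fun ζ => hD ζ trivial⟩
  have hn1 : ∀ ζ : sphere (0 : Cn n) 1, ‖r • (ζ : Cn n)‖ = r := fun ζ => by
    simp [norm_smul, abs_of_nonneg hr0]
  have key := hasSum_integral_of_sum_norm_le (μ := sphereMeasure n)
    (u := fun k (ζ : sphere (0 : Cn n) 1) => a k * mono k (r • (ζ : Cn n)) * conj (mono l ζ))
    (F := fun ζ => f (r • (ζ : Cn n)) * conj (mono l ζ)) (C := C * D)
    (fun k => Continuous.measurable (by fun_prop)) (fun ζ s => by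
      simp only [norm_mul _ (conj _), RCLike.norm_conj, ← Finset.sum_mul]
      exact mul_le_mul (hC _ (hn1 ζ).le s) (hD ζ) (norm_nonneg _) hC0)
    (fun ζ => (h _ (by rw [mem_ball_zero_iff, hn1]; exact hr)).mul_right _)
  have e : ∀ k, ∫ ζ : sphere (0 : Cn n) 1, a k * mono k (r • (ζ : Cn n)) * conj (mono l ζ)
      ∂(sphereMeasure n) = if k = l then a l * r ^ (∑ i, l i) * sphereWeight l else 0 := by
    intro k
    have : ∀ ζ : sphere (0 : Cn n) 1, a k * mono k (r • (ζ : Cn n)) * conj (mono l ζ) =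
        (a k * r ^ (∑ i, k i)) * (mono k (ζ : Cn n) * conj (mono l ζ)) := fun ζ => by
      rw [mono_smul]; ring
    simp_rw [this]
    rw [integral_const_mul, integral_mono_mul_conj_mono hn]
    split_ifs with hkl
    · rw [hkl]
    · simp
  simp_rw [e] at key
  exact key.unique (hasSum_ite_eq l _)

/-- Integrals of f over one small sphere lying in both balls determine the coefficients. -/
theorem hasSum_mono_unique {n : ℕ} (hn : 1 ≤ n) {a b : (Fin n → ℕ) → ℂ}
    {f : Cn n → ℂ} {R R' : ℝ} (hR : 0 < R) (hR' : 0 < R')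
    (ha : ∀ z ∈ ball (0 : Cn n) R, HasSum (fun k => a k * mono k z) (f z))
    (hb : ∀ z ∈ ball (0 : Cn n) R', HasSum (fun k => b k * mono k z) (f z)) : a = b := by
  ext l
  have h0 : 0 < min R R' := lt_min hR hR'
  have h1 := integral_mul_conj_mono_of_hasSum hn (half_pos h0).le
    ((half_lt_self h0).trans_le (min_le_left _ _)) ha l
  rw [integral_mul_conj_mono_of_hasSum hn (half_pos h0).le
    ((half_lt_self h0).trans_le (min_le_right _ _)) hb l] at h1
  have hw := (sphereWeight_pos l).ne'
  have h2 : ((min R R' / 2 : ℝ) : ℂ) ≠ 0 := by exact_mod_cast (half_pos h0).ne'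
  exact (mul_right_cancel₀ (pow_ne_zero _ h2)
    (mul_right_cancel₀ (by exact_mod_cast hw) h1)).symm

/-- The series need not converge on the unit sphere, so the formula is proved on spheres of radius r
< 1 and passed to r → 1 by dominated convergence, using continuity up to the boundary. -/
theorem integral_mul_conj_mono_of_hasExpansion {n : ℕ} (hn : 1 ≤ n) {a : (Fin n → ℕ) → ℂ}
    {f : Cn n → ℂ} (hf : ContinuousOn f (closedBall 0 1)) (ha : HasExpansion f a)
    (l : Fin n → ℕ) :
    ∫ ζ : sphere (0 : Cn n) 1, f ζ * conj (mono l ζ) ∂(sphereMeasure n) =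
      a l * sphereWeight l := by
  have := isProbabilityMeasure_sphereMeasure hn
  obtain ⟨M, hM⟩ := (isCompact_closedBall (0 : Cn n) 1).exists_bound_of_continuousOn hf
  obtain ⟨D, hD⟩ := isCompact_univ.exists_bound_of_continuousOn
      (f := fun ζ : sphere (0 : Cn n) 1 => mono l (ζ : Cn n)) (by fun_prop)
  have hM0 : 0 ≤ M := (norm_nonneg _).trans (hM 0 (by simp))
  have hmem : ∀ r ∈ Set.Ico (0 : ℝ) 1, ∀ ζ : sphere (0 : Cn n) 1,
      r • (ζ : Cn n) ∈ closedBall (0 : Cn n) 1 := fun r hr ζ => by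
    simpa [norm_smul, abs_of_nonneg hr.1] using hr.2.le
  have hev : ∀ᶠ r in 𝓝[<] (1 : ℝ), r ∈ Set.Ico (0 : ℝ) 1 := Ico_mem_nhdsLT (by norm_num)
  have h1 : Tendsto (fun r : ℝ => ∫ ζ : sphere (0 : Cn n) 1,
      f (r • (ζ : Cn n)) * conj (mono l ζ) ∂(sphereMeasure n)) (𝓝[<] 1)
      (𝓝 (∫ ζ : sphere (0 : Cn n) 1, f ζ * conj (mono l ζ) ∂(sphereMeasure n))) := by
    refine tendsto_integral_filter_of_dominated_convergence (fun _ => M * D) ?_ ?_ (integrable_const _) ?_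
    · filter_upwards [hev] with r hr
      refine Continuous.aestronglyMeasurable ?_
      exact (hf.comp_continuous (by fun_prop) (hmem r hr)).mul (by fun_prop)
    · filter_upwards [hev] with r hr
      refine .of_forall fun ζ => ?_
      rw [norm_mul, RCLike.norm_conj]
      exact mul_le_mul (hM _ (hmem r hr ζ)) (hD ζ trivial) (norm_nonneg _) hM0
    · refine .of_forall fun ζ => Tendsto.mul_const _ ?_
      have hc := (hf (ζ : Cn n) (by simp)).tendsto
      refine hc.comp (tendsto_nhdsWithin_iff.2 ⟨?_, ?_⟩)
      · have : Tendsto (fun r : ℝ => r • (ζ : Cn n)) (𝓝 1) (𝓝 ((1 : ℝ) • (ζ : Cn n))) :=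
          Continuous.tendsto (by fun_prop) _
        rw [one_smul] at this
        exact this.mono_left nhdsWithin_le_nhds
      · filter_upwards [hev] with r hr using hmem r hr ζ
  have h2 : Tendsto (fun r : ℝ => a l * (r : ℂ) ^ (∑ i, l i) * (sphereWeight l : ℂ)) (𝓝[<] 1)
      (𝓝 (a l * ((1 : ℝ) : ℂ) ^ (∑ i, l i) * sphereWeight l)) :=
    (Continuous.tendsto (by fun_prop) _).mono_left nhdsWithin_le_nhds
  simp only [Complex.ofReal_one, one_pow, mul_one] at h2
  refine tendsto_nhds_unique (h1.congr' ?_) h2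
  filter_upwards [hev] with r hr
  exact integral_mul_conj_mono_of_hasSum hn hr.1 hr.2 ha l

/-! ### Existence of the power series, by Cauchy's formula on polydiscs. -/

lemma hasSum_mul_prod {ι κ : Type*} {f : ι → ℂ} {g : κ → ℂ} {s t : ℂ} (hf : HasSum f s)
    (hg : HasSum g t) : HasSum (fun x : ι × κ => f x.1 * g x.2) (s * t) :=
  hf.mul hg (summable_mul_of_summable_norm hf.summable.norm hg.summable.norm)

lemma hasSum_prod_pi {n : ℕ} {g : Fin n → ℕ → ℂ} {s : Fin n → ℂ}
    (hg : ∀ i, HasSum (g i) (s i)) :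
    HasSum (fun k : Fin n → ℕ => ∏ i, g i (k i)) (∏ i, s i) := by
  induction n with
  | zero => simp
  | succ n ih =>
    have h1 := ih fun i => hg i.succ
    have h2 := hasSum_mul_prod (hg 0) h1
    rw [Fin.prod_univ_succ, ← (Fin.consEquiv fun _ : Fin (n + 1) => ℕ).hasSum_iff]
    refine h2.congr_fun fun x => ?_
    simp [Fin.prod_univ_succ, Fin.consEquiv]

/-- The iterated Cauchy integral formula on a polydisc. -/
theorem torusIntegral_prod_sub_inv_mul {n : ℕ} {f : (Fin n → ℂ) → ℂ} {ρ : Fin n → ℝ}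
    (hf : ∀ x, (∀ i, ‖x i‖ ≤ ρ i) → DifferentiableAt ℂ f x) {z : Fin n → ℂ}
    (hz : ∀ i, ‖z i‖ < ρ i) :
    torusIntegral (fun ζ => (∏ i, (ζ i - z i)⁻¹) * f ζ) 0 ρ =
      (2 * Real.pi * Complex.I) ^ n * f z := by
  induction n with
  | zero => 
    rw [torusIntegral_dim0]
    simp [Subsingleton.elim z 0]
  | succ n ih =>
    have hρ : ∀ i, 0 < ρ i := fun i => (norm_nonneg _).trans_lt (hz i)
    have hnorm : ∀ θ i, ‖torusMap 0 ρ θ i‖ = ρ i := fun θ i => by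
      simp [torusMap, abs_of_pos (hρ i), Complex.norm_exp_ofReal_mul_I]
    have hint : TorusIntegrable (fun ζ => (∏ i, (ζ i - z i)⁻¹) * f ζ) 0 ρ := by
      refine ContinuousOn.integrableOn_compact isCompact_Icc (Continuous.continuousOn ?_)
      have hT : Continuous (torusMap (0 : Fin (n + 1) → ℂ) ρ) := by unfold torusMap; fun_prop
      refine Continuous.mul (continuous_finsetProd _ fun i _ => ?_) ?_
      · refine Continuous.inv₀ (by fun_prop) fun θ => sub_ne_zero.2 fun h => ?_
        have := hz i
        rw [← h, hnorm] at this
        exact lt_irrefl _ this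
      · refine continuous_iff_continuousAt.2 fun θ => ?_
        exact (hf _ fun i => (hnorm θ i).le).continuousAt.comp hT.continuousAt
    have hcons : ∀ x : ℂ, ∀ y : Fin n → ℂ, DifferentiableAt ℂ
        (fun y : Fin n → ℂ => (Fin.cons x y : Fin (n + 1) → ℂ)) y := fun x y => by
      refine differentiableAt_pi.2 fun i => ?_
      refine Fin.cases ?_ (fun j => ?_) i
      · simp
      · simp only [Fin.cons_succ]; fun_prop
    have hcons' : ∀ x : ℂ, ∀ y : Fin n → ℂ, DifferentiableAt ℂ
        (fun x : ℂ => (Fin.cons x y : Fin (n + 1) → ℂ)) x := fun x y => by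
      refine differentiableAt_pi.2 fun i => ?_
      refine Fin.cases ?_ (fun j => ?_) i
      · simp only [Fin.cons_zero]; fun_prop
      · simp
    rw [torusIntegral_succ hint]
    -- With the first variable frozen, the inner torus integral is the induction hypothesis; the
    -- remaining circle integral is Cauchy's formula in one variable.
    have hin : ∀ x : ℂ, ‖x‖ ≤ ρ 0 →
        torusIntegral (fun y : Fin n → ℂ => (∏ i, ((Fin.cons x y : Fin (n + 1) → ℂ) i - z i)⁻¹) *
          f (Fin.cons x y)) ((0 : Fin (n + 1) → ℂ) ∘ Fin.succ) (ρ ∘ Fin.succ) =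
        (x - z 0)⁻¹ * ((2 * Real.pi * Complex.I) ^ n * f (Fin.cons x (Fin.tail z))) := by
      intro x hx
      rw [← ih (f := fun y => f (Fin.cons x y)) (ρ := ρ ∘ Fin.succ) (z := Fin.tail z)
        (fun y hy => ?_) (fun i => hz i.succ), ← torusIntegral_const_mul]
      · simp only [Fin.prod_univ_succ, Fin.cons_zero, Fin.cons_succ, mul_assoc]
        rfl
      · refine DifferentiableAt.comp y (hf _ ?_) (hcons x y)
        exact Fin.cases (by simpa using hx) (by simpa using hy)
    rw [circleIntegral.integral_congr (g := fun x =>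
      (x - z 0)⁻¹ • ((2 * Real.pi * Complex.I) ^ n * f (Fin.cons x (Fin.tail z)))) (hρ 0).le
      (fun x hx => by
        have hx' : ‖x‖ = ρ 0 := by simpa using hx
        exact hin x hx'.le)]
    have hd : ∀ x ∈ closedBall (0 : ℂ) (ρ 0), DifferentiableAt ℂ
        (fun x => (2 * Real.pi * Complex.I) ^ n * f (Fin.cons x (Fin.tail z))) x := by
      intro x hx
      refine DifferentiableAt.const_mul (DifferentiableAt.comp x (hf _ ?_) (hcons' x _)) _
      exact Fin.cases (by simpa using hx) fun i => by simpa [Fin.tail] using (hz i.succ).le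
    have := Complex.circleIntegral_sub_inv_smul_of_differentiable_on_off_countable
      (c := (0 : ℂ)) (R := ρ 0) (w := z 0) (s := ∅)
      (f := fun x => (2 * Real.pi * Complex.I) ^ n * f (Fin.cons x (Fin.tail z)))
      Set.countable_empty (by simpa using hz 0)
      (fun x hx => (hd x hx).continuousAt.continuousWithinAt)
      (fun x hx => hd x (ball_subset_closedBall hx.1))
    simp only [Pi.zero_apply]
    rw [this, Fin.cons_self_tail, pow_succ, smul_eq_mul]
    ring

/-- A holomorphic function on a polydisc is the sum of its power series. -/
theorem exists_hasSum_of_differentiableAt_polydisc {n : ℕ} {f : (Fin n → ℂ) → ℂ} {ρ : Fin n → ℝ}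
    (hρ : ∀ i, 0 < ρ i) (hf : ∀ x, (∀ i, ‖x i‖ ≤ ρ i) → DifferentiableAt ℂ f x) :
    ∃ a : (Fin n → ℕ) → ℂ, ∀ z, (∀ i, ‖z i‖ < ρ i) →
      HasSum (fun k => a k * ∏ i, z i ^ k i) (f z) := by
  -- The Jacobian of the torus parametrization times f; it is bounded, so only the Cauchy kernel has
  -- to be expanded, as a product of geometric series.
  set w : (Fin n → ℝ) → ℂ := fun θ =>
    (∏ i, (ρ i * Complex.exp (θ i * Complex.I) * Complex.I : ℂ)) * f (torusMap 0 ρ θ) with hw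
  have hT : Continuous (torusMap (0 : Fin n → ℂ) ρ) := by unfold torusMap; fun_prop
  have hnorm : ∀ θ i, ‖torusMap 0 ρ θ i‖ = ρ i := fun θ i => by
    simp [torusMap, abs_of_pos (hρ i), Complex.norm_exp_ofReal_mul_I]
  have hne : ∀ θ i, torusMap 0 ρ θ i ≠ 0 := fun θ i => norm_ne_zero_iff.1 (by
    rw [hnorm]; exact (hρ i).ne')
  have hwc : Continuous w := by
    refine Continuous.mul (by fun_prop) (continuous_iff_continuousAt.2 fun θ => ?_)
    exact (hf _ fun i => (hnorm θ i).le).continuousAt.comp hT.continuousAt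
  obtain ⟨M, hM⟩ : ∃ M, ∀ θ, ‖w θ‖ ≤ M := by
    have hcp : IsCompact {x : Fin n → ℂ | ∀ i, ‖x i‖ ≤ ρ i} := by
      have : {x : Fin n → ℂ | ∀ i, ‖x i‖ ≤ ρ i} = Set.pi Set.univ fun i => closedBall 0 (ρ i) := by
        ext; simp
      rw [this]
      exact isCompact_univ_pi fun i => isCompact_closedBall _ _
    obtain ⟨M, hM⟩ := hcp.exists_bound_of_continuousOn (f := f) fun x hx =>
      (hf x hx).continuousAt.continuousWithinAt
    refine ⟨(∏ i, ρ i) * M, fun θ => ?_⟩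
    rw [hw, norm_mul, norm_prod]
    have : ∀ i, ‖(ρ i * Complex.exp (θ i * Complex.I) * Complex.I : ℂ)‖ = ρ i := fun i => by
      simp [abs_of_pos (hρ i), Complex.norm_exp_ofReal_mul_I]
    simp_rw [this]
    exact mul_le_mul_of_nonneg_left (hM _ fun i => (hnorm θ i).le)
      (Finset.prod_nonneg fun i _ => (hρ i).le)
  have hM0 : 0 ≤ M := (norm_nonneg _).trans (hM 0)
  have hfin : IsFiniteMeasure (volume.restrict (Set.Icc (0 : Fin n → ℝ) fun _ => 2 * Real.pi)) :=
    ⟨by simpa using isCompact_Icc.measure_lt_top⟩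
  refine ⟨fun k => ((2 * Real.pi * Complex.I) ^ n)⁻¹ * ∫ θ in Set.Icc (0 : Fin n → ℝ)
    fun _ => 2 * Real.pi, w θ * ∏ i, (torusMap 0 ρ θ i ^ (k i + 1))⁻¹, fun z hz => ?_⟩
  have hsum : Summable fun k : Fin n → ℕ => ∏ i, (‖z i‖ / ρ i) ^ k i := by
    have := (hasSum_prod_pi fun i => hasSum_geometric_of_norm_lt_one
      (ξ := ((‖z i‖ / ρ i : ℝ) : ℂ)) (by
        rw [Complex.norm_real, Real.norm_eq_abs, abs_of_nonneg (by have := hρ i; positivity)]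
        exact (div_lt_one (hρ i)).2 (hz i))).summable
    exact_mod_cast this
  have hgeo : ∀ θ i, HasSum (fun m : ℕ => (torusMap 0 ρ θ i)⁻¹ * (z i / torusMap 0 ρ θ i) ^ m)
      (torusMap 0 ρ θ i - z i)⁻¹ := fun θ i => by
    have h1 := (hasSum_geometric_of_norm_lt_one (ξ := z i / torusMap 0 ρ θ i) (by
      rw [norm_div, hnorm]; exact (div_lt_one (hρ i)).2 (hz i))).mul_left (torusMap 0 ρ θ i)⁻¹
    have h2 : (torusMap 0 ρ θ i)⁻¹ * (1 - z i / torusMap 0 ρ θ i)⁻¹ =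
        (torusMap 0 ρ θ i - z i)⁻¹ := by
      rw [← mul_inv, mul_sub, mul_one, mul_div_cancel₀ _ (hne θ i)]
    rwa [h2] at h1
  have key := hasSum_integral_of_sum_norm_le
    (μ := volume.restrict (Set.Icc (0 : Fin n → ℝ) fun _ => 2 * Real.pi))
    (u := fun (k : Fin n → ℕ) θ => w θ * ∏ i, ((torusMap 0 ρ θ i)⁻¹ *
      (z i / torusMap 0 ρ θ i) ^ k i))
    (F := fun θ => w θ * ∏ i, (torusMap 0 ρ θ i - z i)⁻¹)
    (C := M * ((∏ i, (ρ i)⁻¹) * ∑' k : Fin n → ℕ, ∏ i, (‖z i‖ / ρ i) ^ k i))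
    (fun k => by
      refine Continuous.measurable (hwc.mul (continuous_finsetProd _ fun i _ => ?_))
      have h1 : Continuous fun θ => (torusMap 0 ρ θ i)⁻¹ :=
        Continuous.inv₀ (by fun_prop) fun θ => hne θ i
      simp only [div_eq_mul_inv]
      fun_prop)
    (fun θ s => by
      simp only [norm_mul, ← Finset.mul_sum, norm_prod, Finset.prod_mul_distrib, norm_inv, hnorm]
      refine mul_le_mul (hM θ) ?_ ?_ hM0
      · refine mul_le_mul_of_nonneg_left ?_ (Finset.prod_nonneg fun i _ => (inv_pos.2 (hρ i)).le)
        simp only [norm_pow, norm_div, hnorm]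
        exact hsum.sum_le_tsum s fun k _ => Finset.prod_nonneg fun i _ => by
          have := hρ i; positivity
      · have : ∀ i, 0 ≤ (ρ i)⁻¹ := fun i => (inv_pos.2 (hρ i)).le
        exact mul_nonneg (Finset.prod_nonneg fun i _ => this i)
          (Finset.sum_nonneg fun k _ => Finset.prod_nonneg fun i _ => by positivity))
    (fun θ => HasSum.mul_left _ (hasSum_prod_pi (g := fun i m => (torusMap 0 ρ θ i)⁻¹ *
      (z i / torusMap 0 ρ θ i) ^ m) fun i => hgeo θ i))
  have hC := torusIntegral_prod_sub_inv_mul hf hz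
  have hC' : ∫ θ in Set.Icc (0 : Fin n → ℝ) fun _ => 2 * Real.pi,
      w θ * ∏ i, (torusMap 0 ρ θ i - z i)⁻¹ = (2 * Real.pi * Complex.I) ^ n * f z := by
    rw [← hC, torusIntegral]
    refine integral_congr_ae (.of_forall fun θ => ?_)
    simp only [hw, smul_eq_mul]
    ring
  rw [hC'] at key
  have h2 : ((2 * Real.pi * Complex.I : ℂ)) ^ n ≠ 0 := pow_ne_zero _ Complex.two_pi_I_ne_zero
  have key2 := key.mul_left ((2 * Real.pi * Complex.I : ℂ) ^ n)⁻¹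
  rw [inv_mul_cancel_left₀ h2] at key2
  refine key2.congr_fun fun k => ?_
  rw [mul_assoc, ← integral_mul_const]
  congr 1
  refine integral_congr_ae (.of_forall fun θ => ?_)
  simp only
  rw [mul_assoc, ← Finset.prod_mul_distrib]
  congr 1
  refine Finset.prod_congr rfl fun i _ => ?_
  rw [div_pow, pow_succ, mul_inv]
  ring

/-- Every point of the ball lies in a polydisc about 0 whose closure stays in the ball, and f has a
power series there. All these series represent f near 0, so by uniqueness they coincide. -/
theorem exists_hasExpansion {n : ℕ} (hn : 1 ≤ n) {f : Cn n → ℂ}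
    (hf : DifferentiableOn ℂ f (unitBall n)) : ∃ a, HasExpansion f a := by
  have hat : ∀ x ∈ unitBall n, DifferentiableAt ℂ f x := fun x hx =>
    (hf x hx).differentiableAt (isOpen_ball.mem_nhds hx)
  -- each point of the ball lies in a closed polydisc contained in the ball
  have hpoly : ∀ x ∈ unitBall n, ∃ ρ : Fin n → ℝ, (∀ i, ‖x i‖ < ρ i) ∧
      ∀ y : Cn n, (∀ i, ‖y i‖ ≤ ρ i) → y ∈ unitBall n := by
    intro x hx
    let y : ℝ → Cn n := fun ε => WithLp.toLp 2 fun i => ((‖x i‖ + ε : ℝ) : ℂ)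
    have hy : Continuous y := by fun_prop
    have hy0 : ‖y 0‖ < 1 := by
      have : ‖y 0‖ = ‖x‖ := by simp [y, EuclideanSpace.norm_eq]
      rw [this]
      exact mem_ball_zero_iff.1 hx
    obtain ⟨ε, hε0, hε⟩ : ∃ ε > 0, ‖y ε‖ < 1 := by
      have h1 : ∀ᶠ ε in 𝓝[>] (0 : ℝ), ‖y ε‖ < 1 :=
        (hy.norm.tendsto 0).eventually_lt_const hy0 |>.filter_mono nhdsWithin_le_nhds
      obtain ⟨ε, h1, h2⟩ := (h1.and self_mem_nhdsWithin).exists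
      exact ⟨ε, h2, h1⟩
    refine ⟨fun i => ‖x i‖ + ε, fun i => by linarith, fun v hv => ?_⟩
    refine mem_ball_zero_iff.2 (lt_of_le_of_lt ?_ hε)
    rw [EuclideanSpace.norm_eq, EuclideanSpace.norm_eq]
    refine Real.sqrt_le_sqrt (Finset.sum_le_sum fun i _ => ?_)
    refine pow_le_pow_left₀ (norm_nonneg _) ?_ 2
    have : 0 ≤ ‖x i‖ + ε := by positivity
    simpa [y, abs_of_nonneg this, ← Complex.ofReal_add] using hv i
  have hexp : ∀ x ∈ unitBall n, ∃ a : (Fin n → ℕ) → ℂ, HasSum (fun k => a k * mono k x) (f x) ∧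
      ∃ R > 0, ∀ z ∈ ball (0 : Cn n) R, HasSum (fun k => a k * mono k z) (f z) := by
    intro x hx
    obtain ⟨ρ, hρx, hρ⟩ := hpoly x hx
    have hρ0 : ∀ i, 0 < ρ i := fun i => (norm_nonneg _).trans_lt (hρx i)
    obtain ⟨a, ha⟩ := exists_hasSum_of_differentiableAt_polydisc (f := fun v => f (WithLp.toLp 2 v))
      hρ0 fun v hv => DifferentiableAt.comp v (hat _ (hρ _ hv))
        (EuclideanSpace.equiv (Fin n) ℂ).symm.differentiableAt
    refine ⟨a, ha x hρx, ?_⟩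
    have : Nonempty (Fin n) := ⟨⟨0, hn⟩⟩
    refine ⟨Finset.univ.inf' Finset.univ_nonempty ρ, ?_, fun z hz => ha z fun i => ?_⟩
    · simpa using hρ0
    · exact (PiLp.norm_apply_le z i).trans_lt ((mem_ball_zero_iff.1 hz).trans_le
        (Finset.inf'_le _ (Finset.mem_univ i)))
  obtain ⟨a, -, R, hR, ha⟩ := hexp 0 (by simp)
  refine ⟨a, fun z hz => ?_⟩
  obtain ⟨b, hb, R', hR', hb'⟩ := hexp z hz
  rw [hasSum_mono_unique hn hR hR' ha hb']
  exact hb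

/-! ### Expansion of the kernel (1 - ⟨z, ζ⟩)^{-β} in monomials. -/

/-- The rising factorial `β (β + 1) ⋯ (β + m - 1)`. -/
def risingFactorial (β : ℝ) (m : ℕ) : ℝ := ∏ j ∈ Finset.range m, (β + j)

lemma risingFactorial_pos {β : ℝ} (hβ : 0 < β) (m : ℕ) : 0 < risingFactorial β m :=
  Finset.prod_pos fun j _ => by positivity

lemma ascPochhammer_eval_eq_risingFactorial (β : ℝ) (m : ℕ) :
    (ascPochhammer ℝ m).eval β = risingFactorial β m := by
  induction m with
  | zero => simp [risingFactorial]
  | succ m ih =>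
    rw [ascPochhammer_succ_right]
    simp [ih, risingFactorial, Finset.prod_range_succ]

lemma ringChoose_eq_risingFactorial_div (β : ℝ) (m : ℕ) :
    Ring.choose (β + m - 1) m = risingFactorial β m / (m ! : ℝ) := by
  have h := Ring.factorial_nsmul_multichoose_eq_ascPochhammer β m
  rw [Ring.multichoose_eq, Polynomial.ascPochhammer_smeval_eq_eval,
    ascPochhammer_eval_eq_risingFactorial, nsmul_eq_mul] at h
  rw [← h]
  have : (m ! : ℝ) ≠ 0 := by positivity
  field_simp

lemma hasSum_one_div_one_sub_cpow (β : ℝ) {x : ℂ} (hx : ‖x‖ < 1) :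
    HasSum (fun m : ℕ => ((risingFactorial β m / (m ! : ℝ) : ℝ) : ℂ) * x ^ m)
      (1 / (1 - x) ^ (β : ℂ)) := by
  have h := (Complex.one_div_one_sub_cpow_hasFPowerSeriesOnBall_zero (β : ℂ)).hasSum (y := x) (by
    rw [← ENNReal.ofReal_one, Metric.eball_ofReal]; simpa using hx)
  simp only [zero_add] at h
  refine h.congr_fun fun m => ?_
  rw [← ringChoose_eq_risingFactorial_div, Complex.ofReal_choose]
  simp [mul_comm]

section Multinomial

variable {n : ℕ} {x : Fin n → ℂ} {c : ℕ → ℂ}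

/-- Grouping the multi-indices by degree, each group is part of the multinomial expansion of (∑
|x_i|)^m. -/
lemma sum_norm_multinomial_le (hs : Summable fun m => ‖c m‖ * (∑ i, ‖x i‖) ^ m)
    (s : Finset (Fin n → ℕ)) :
    ∑ k ∈ s, ‖c (∑ i, k i) * Nat.multinomial Finset.univ k * ∏ i, x i ^ k i‖ ≤
      ∑' m, ‖c m‖ * (∑ i, ‖x i‖) ^ m := by
  classical
  obtain ⟨d, hd⟩ : ∃ d : (Fin n → ℕ) → ℕ, ∀ k, d k = ∑ i, k i := ⟨_, fun _ => rfl⟩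
  simp only [← hd]
  rw [← Finset.sum_fiberwise_of_maps_to (t := s.image d) fun k hk => Finset.mem_image_of_mem d hk]
  refine le_trans (Finset.sum_le_sum fun m _ => ?_)
    (hs.sum_le_tsum (f := fun m => ‖c m‖ * (∑ i, ‖x i‖) ^ m) (s.image d) fun m _ => by positivity)
  rw [Finset.sum_pow_eq_sum_piAntidiag, Finset.mul_sum]
  refine le_trans (Finset.sum_le_sum_of_subset_of_nonneg (t := Finset.univ.piAntidiag m) ?_
    fun k _ _ => norm_nonneg _) (Finset.sum_le_sum fun k hk => ?_)
  · intro k hk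
    simpa [Finset.mem_piAntidiag, ← hd] using (Finset.mem_filter.1 hk).2
  · have hk' : ∑ i, k i = m := (Finset.mem_piAntidiag.1 hk).1
    rw [hd, hk', norm_mul, norm_mul, norm_prod, mul_assoc]
    simp

lemma hasSum_multinomial (hs : Summable fun m => ‖c m‖ * (∑ i, ‖x i‖) ^ m) {S : ℂ}
    (hS : HasSum (fun m => c m * (∑ i, x i) ^ m) S) :
    HasSum (fun k : Fin n → ℕ => c (∑ i, k i) * Nat.multinomial Finset.univ k * ∏ i, x i ^ k i)
      S := by
  classical
  have hsum : Summable fun k : Fin n → ℕ =>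
      c (∑ i, k i) * Nat.multinomial Finset.univ k * ∏ i, x i ^ k i :=
    (summable_of_sum_le (fun k => norm_nonneg _) (sum_norm_multinomial_le hs)).of_norm
  -- Summability being known, the sum may be computed along the multi-indices of degree < N, where
  -- it is a partial sum of the one-variable series.
  have hT : Tendsto (fun N => (Finset.range N).biUnion fun m =>
      (Finset.univ : Finset (Fin n)).piAntidiag m) atTop atTop := by
    refine tendsto_atTop_finset_of_monotone (fun M N h => ?_) fun k => ⟨∑ i, k i + 1, ?_⟩
    · exact Finset.biUnion_subset_biUnion_of_subset_left _ (Finset.range_mono h)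
    · simp [Finset.mem_piAntidiag]
  have h1 := hsum.hasSum.comp hT
  have h2 := hS.tendsto_sum_nat
  have : ∀ N, ∑ k ∈ (Finset.range N).biUnion fun m => (Finset.univ : Finset (Fin n)).piAntidiag m,
      c (∑ i, k i) * Nat.multinomial Finset.univ k * ∏ i, x i ^ k i =
      ∑ m ∈ Finset.range N, c m * (∑ i, x i) ^ m := by
    intro N
    rw [Finset.sum_biUnion]
    · refine Finset.sum_congr rfl fun m _ => ?_
      rw [Finset.sum_pow_eq_sum_piAntidiag, Finset.mul_sum]
      refine Finset.sum_congr rfl fun k hk => ?_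
      rw [(Finset.mem_piAntidiag.1 hk).1, mul_assoc]
    · intro m _ m' _ hmm
      refine Finset.disjoint_left.2 fun k hk hk' => hmm ?_
      rw [← (Finset.mem_piAntidiag.1 hk).1, ← (Finset.mem_piAntidiag.1 hk').1]
  rw [tendsto_nhds_unique h2 (h1.congr this)]
  exact hsum.hasSum

end Multinomial

lemma sum_norm_mul_conj_le {n : ℕ} (z ζ : Cn n) : ∑ i, ‖z i * conj (ζ i)‖ ≤ ‖z‖ * ‖ζ‖ := by
  simp only [norm_mul, RCLike.norm_conj]
  rw [EuclideanSpace.norm_eq, EuclideanSpace.norm_eq]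
  exact Real.sum_mul_le_sqrt_mul_sqrt Finset.univ (fun i => ‖z i‖) fun i => ‖ζ i‖

lemma herm_eq_sum {n : ℕ} (z ζ : Cn n) : herm z ζ = ∑ i, z i * conj (ζ i) := by
  simp [herm, PiLp.inner_apply]

/-- The coefficient of `z^k ζ̄^k` in `(1 - ⟨z, ζ⟩)^{-β}`. -/
noncomputable def kernelCoeff {n : ℕ} (β : ℝ) (k : Fin n → ℕ) : ℝ :=
  risingFactorial β (∑ i, k i) / ∏ i, ((k i)! : ℝ)

lemma kernelCoeff_eq {n : ℕ} (β : ℝ) (k : Fin n → ℕ) :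
    kernelCoeff β k = risingFactorial β (∑ i, k i) / ((∑ i, k i)! : ℝ) *
      Nat.multinomial Finset.univ k := by
  have h : (∏ i, ((k i)! : ℝ)) * (Nat.multinomial Finset.univ k : ℝ) = ((∑ i, k i)! : ℝ) := by
    exact_mod_cast Nat.multinomial_spec Finset.univ k
  have h1 : ∏ i, ((k i)! : ℝ) ≠ 0 := Finset.prod_ne_zero_iff.2 fun i _ => by positivity
  have h2 : ((∑ i, k i)! : ℝ) ≠ 0 := by positivity
  unfold kernelCoeff
  rw [div_mul_eq_mul_div, div_eq_div_iff h1 h2, ← h]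
  ring

section Kernel

variable {n : ℕ} {β : ℝ} {z ζ : Cn n}

lemma summable_kernel_bound {t : ℝ} (ht0 : 0 ≤ t) (ht : t < 1) :
    Summable fun m : ℕ => ‖((risingFactorial β m / (m ! : ℝ) : ℝ) : ℂ)‖ * t ^ m := by
  have := (hasSum_one_div_one_sub_cpow β (x := (t : ℂ)) (by simpa [abs_of_nonneg ht0])).summable.norm
  simpa [abs_of_nonneg ht0] using this

lemma kernel_term_eq (k : Fin n → ℕ) :
    (kernelCoeff β k : ℂ) * mono k z * conj (mono k ζ) =
      ((risingFactorial β (∑ i, k i) / ((∑ i, k i)! : ℝ) : ℝ) : ℂ) *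
        Nat.multinomial Finset.univ k * ∏ i, (z i * conj (ζ i)) ^ k i := by
  rw [kernelCoeff_eq]
  simp only [mono, map_prod, map_pow, mul_pow, Finset.prod_mul_distrib]
  push_cast
  ring

lemma summable_kernel_majorant (hz : ‖z‖ < 1) (hζ : ‖ζ‖ = 1) :
    Summable fun m : ℕ => ‖((risingFactorial β m / (m ! : ℝ) : ℝ) : ℂ)‖ *
      (∑ i, ‖z i * conj (ζ i)‖) ^ m :=
  summable_kernel_bound (Finset.sum_nonneg fun i _ => norm_nonneg _)
    (((sum_norm_mul_conj_le z ζ).trans_eq (by rw [hζ, mul_one])).trans_lt hz)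

lemma hasSum_kernel (hz : ‖z‖ < 1) (hζ : ‖ζ‖ = 1) :
    HasSum (fun k => (kernelCoeff β k : ℂ) * mono k z * conj (mono k ζ))
      (1 / (1 - herm z ζ) ^ (β : ℂ)) := by
  simp only [kernel_term_eq]
  rw [herm_eq_sum]
  refine hasSum_multinomial (c := fun m => ((risingFactorial β m / (m ! : ℝ) : ℝ) : ℂ))
    (summable_kernel_majorant hz hζ) (hasSum_one_div_one_sub_cpow β ?_)
  refine ((norm_sum_le _ _).trans (sum_norm_mul_conj_le z ζ)).trans_lt ?_
  rwa [hζ, mul_one]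

/-- By Cauchy–Schwarz ∑ |z_i ζ_i| ≤ ‖z‖. The bound is independent of ζ, as termwise integration over
the sphere requires. -/
lemma sum_norm_kernel_le (hz : ‖z‖ < 1) (hζ : ‖ζ‖ = 1) (s : Finset (Fin n → ℕ)) :
    ∑ k ∈ s, ‖(kernelCoeff β k : ℂ) * mono k z * conj (mono k ζ)‖ ≤
      ∑' m : ℕ, ‖((risingFactorial β m / (m ! : ℝ) : ℝ) : ℂ)‖ * ‖z‖ ^ m := by
  simp only [kernel_term_eq]
  refine (sum_norm_multinomial_le (c := fun m => ((risingFactorial β m / (m ! : ℝ) : ℝ) : ℂ))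
    (summable_kernel_majorant hz hζ) s).trans ?_
  refine (summable_kernel_majorant hz hζ).tsum_le_tsum (fun m => ?_)
    (summable_kernel_bound (norm_nonneg z) hz)
  gcongr
  exact (sum_norm_mul_conj_le z ζ).trans_eq (by rw [hζ, mul_one])

/-- The kernel of exponent `β` has a bounded integral against continuous functions, computed
termwise. -/
lemma hasSum_integral_mul_kernel (hn : 1 ≤ n) (hz : ‖z‖ < 1)
    {g : sphere (0 : Cn n) 1 → ℂ} (hg : Continuous g) :
    HasSum (fun k => (kernelCoeff β k : ℂ) * mono k z *
        ∫ ζ : sphere (0 : Cn n) 1, g ζ * conj (mono k ζ) ∂(sphereMeasure n))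
      (∫ ζ : sphere (0 : Cn n) 1, g ζ / (1 - herm z ζ) ^ (β : ℂ) ∂(sphereMeasure n)) := by
  have := isProbabilityMeasure_sphereMeasure hn
  obtain ⟨M, hM⟩ := isCompact_univ.exists_bound_of_continuousOn hg.continuousOn
  have hζ : ∀ ζ : sphere (0 : Cn n) 1, ‖(ζ : Cn n)‖ = 1 := fun ζ => by simp
  have key := hasSum_integral_of_sum_norm_le (μ := sphereMeasure n)
    (u := fun k (ζ : sphere (0 : Cn n) 1) =>
      g ζ * ((kernelCoeff β k : ℂ) * mono k z * conj (mono k (ζ : Cn n))))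
    (F := fun ζ => g ζ * (1 / (1 - herm z ζ) ^ (β : ℂ)))
    (C := M * ∑' m : ℕ, ‖((risingFactorial β m / (m ! : ℝ) : ℝ) : ℂ)‖ * ‖z‖ ^ m)
    (fun k => Continuous.measurable (by fun_prop)) (fun ζ s => by
      simp only [norm_mul (g _), ← Finset.mul_sum]
      exact mul_le_mul (hM ζ trivial) (sum_norm_kernel_le hz (hζ ζ) s)
        (Finset.sum_nonneg fun i _ => norm_nonneg _) ((norm_nonneg _).trans (hM ζ trivial)))
    (fun ζ => (hasSum_kernel hz (hζ ζ)).mul_left _)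
  simp only [mul_one_div] at key
  refine key.congr_fun fun k => ?_
  rw [← integral_const_mul]
  congr 1
  ext ζ
  ring

end Kernel

/-! ### Parseval's identity in the ball and the radial integrals. -/

section Parseval

variable {n : ℕ} {ι : Type*} [Countable ι] {b : ι → ℂ} {e : ι → Cn n → ℂ} {d : ι → ℕ}
  {F : Cn n → ℂ} {ω : ℝ → ℝ}

/-- Parseval's identity in the ball, with a radial weight, for a series of homogeneous functions
that are pairwise orthogonal on the sphere. -/
theorem lintegral_ball_norm_sq_of_hasSum_orthogonal (hn : 1 ≤ n) (he : ∀ i, Continuous (e i))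
    (hd : ∀ i (r : ℝ) z, e i (r • z) = (r : ℂ) ^ d i * e i z)
    (ho : ∀ i j, i ≠ j →
      ∫ ζ : sphere (0 : Cn n) 1, e i ζ * conj (e j ζ) ∂(sphereMeasure n) = 0)
    (hF : ∀ z ∈ unitBall n, HasSum (fun i => b i * e i z) (F z))
    (hC : ∀ r < 1, ∃ C, ∀ z, ‖z‖ ≤ r → ∀ s : Finset ι, ∑ i ∈ s, ‖b i * e i z‖ ≤ C)
    (hω : Measurable ω) (hω0 : ∀ r ∈ Set.Ioo (0 : ℝ) 1, 0 ≤ ω r) :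
    ∫⁻ z in unitBall n, ENNReal.ofReal (ω ‖z‖ * ‖F z‖ ^ 2) ∂(ballMeasure n) =
      ∑' i, ENNReal.ofReal (‖b i‖ ^ 2 * ∫ ζ : sphere (0 : Cn n) 1, ‖e i ζ‖ ^ 2 ∂(sphereMeasure n)) *
        ∫⁻ r in Set.Ioo (0 : ℝ) 1,
          ENNReal.ofReal (2 * n * r ^ (2 * n - 1) * (r ^ (2 * d i) * ω r)) := by
  have := isProbabilityMeasure_sphereMeasure hn
  -- Nothing is known about F outside the ball; cut off by zero, it is a pointwise sum of measurable
  -- functions.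
  set G : Cn n → ℂ := (unitBall n).indicator F with hG
  have hGm : Measurable G := by
    refine measurable_of_hasSum (u := fun i => (unitBall n).indicator fun z => b i * e i z)
      (fun i => ((he i).measurable.const_mul _).indicator measurableSet_ball) fun z => ?_
    by_cases hz : z ∈ unitBall n
    · simpa only [hG, Set.indicator_of_mem hz] using hF z hz
    · simpa only [hG, Set.indicator_of_notMem hz] using hasSum_zero
  have h1 : ∫⁻ z in unitBall n, ENNReal.ofReal (ω ‖z‖ * ‖F z‖ ^ 2) ∂(ballMeasure n) =
      ∫⁻ z in unitBall n, ENNReal.ofReal (ω ‖z‖ * ‖G z‖ ^ 2) ∂(ballMeasure n) := by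
    refine setLIntegral_congr_fun measurableSet_ball fun z hz => ?_
    simp only [hG, Set.indicator_of_mem hz]
  rw [h1, lintegral_ballMeasure_polar hn (by fun_prop)]
  have h2 : ∀ r ∈ Set.Ioo (0 : ℝ) 1, ENNReal.ofReal (2 * n * r ^ (2 * n - 1)) *
      ∫⁻ ζ : sphere (0 : Cn n) 1, ENNReal.ofReal (ω ‖r • (ζ : Cn n)‖ * ‖G (r • (ζ : Cn n))‖ ^ 2)
        ∂(sphereMeasure n) =
      ∑' i, ENNReal.ofReal (‖b i‖ ^ 2 *
        ∫ ζ : sphere (0 : Cn n) 1, ‖e i ζ‖ ^ 2 ∂(sphereMeasure n)) *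
          ENNReal.ofReal (2 * n * r ^ (2 * n - 1) * (r ^ (2 * d i) * ω r)) := by
    intro r hr
    have hr' : ∀ ζ : sphere (0 : Cn n) 1, ‖r • (ζ : Cn n)‖ = r := fun ζ => by
      simp [norm_smul, abs_of_pos hr.1]
    have hb : ∀ ζ : sphere (0 : Cn n) 1, r • (ζ : Cn n) ∈ unitBall n := fun ζ => by
      rw [mem_ball_zero_iff, hr']; exact hr.2
    obtain ⟨C, hC⟩ := hC r hr.2
    have hP := lintegral_norm_sq_of_hasSum_orthogonal (μ := sphereMeasure n)
      (u := fun i (ζ : sphere (0 : Cn n) 1) => b i * e i (r • (ζ : Cn n)))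
      (F := fun ζ => F (r • (ζ : Cn n))) (C := C)
      (fun i => Continuous.measurable (by have := he i; fun_prop))
      (fun ζ s => hC _ (hr' ζ).le s) (fun ζ => hF _ (hb ζ)) (fun i j hij => by
        have : ∀ ζ : sphere (0 : Cn n) 1,
            b i * e i (r • (ζ : Cn n)) * conj (b j * e j (r • (ζ : Cn n))) =
            (b i * conj (b j) * (r : ℂ) ^ d i * (r : ℂ) ^ d j) * (e i ζ * conj (e j ζ)) := by
          intro ζ
          simp only [hd, map_mul, map_pow, Complex.conj_ofReal]
          ring
        simp_rw [this]
        rw [integral_const_mul, ho i j hij, mul_zero])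
    have h3 : ∀ i, ∫ ζ : sphere (0 : Cn n) 1, ‖b i * e i (r • (ζ : Cn n))‖ ^ 2 ∂(sphereMeasure n) =
        r ^ (2 * d i) * (‖b i‖ ^ 2 *
          ∫ ζ : sphere (0 : Cn n) 1, ‖e i ζ‖ ^ 2 ∂(sphereMeasure n)) := by
      intro i
      rw [← integral_const_mul, ← integral_const_mul]
      congr 1
      ext ζ
      simp only [hd, norm_mul, norm_pow, Complex.norm_real, Real.norm_eq_abs, abs_of_pos hr.1]
      ring
    have h4 : ∫⁻ ζ : sphere (0 : Cn n) 1,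
        ENNReal.ofReal (ω ‖r • (ζ : Cn n)‖ * ‖G (r • (ζ : Cn n))‖ ^ 2) ∂(sphereMeasure n) =
        ENNReal.ofReal (ω r) *
          ∫⁻ ζ : sphere (0 : Cn n) 1, ENNReal.ofReal (‖F (r • (ζ : Cn n))‖ ^ 2)
            ∂(sphereMeasure n) := by
      rw [← lintegral_const_mul' _ _ ENNReal.ofReal_ne_top]
      refine lintegral_congr fun ζ => ?_
      rw [hr', hG, Set.indicator_of_mem (hb ζ), ENNReal.ofReal_mul (hω0 r hr)]
    rw [h4, hP, ← ENNReal.tsum_mul_left, ← ENNReal.tsum_mul_left]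
    refine tsum_congr fun i => ?_
    have hr0 := hr.1
    have hωr := hω0 r hr
    have hN : 0 ≤ ∫ ζ : sphere (0 : Cn n) 1, ‖e i ζ‖ ^ 2 ∂(sphereMeasure n) :=
      integral_nonneg fun ζ => by positivity
    rw [h3, ← ENNReal.ofReal_mul hωr, ← ENNReal.ofReal_mul (by positivity),
      ← ENNReal.ofReal_mul (by positivity)]
    congr 1
    ring
  rw [setLIntegral_congr_fun measurableSet_Ioo h2, lintegral_tsum fun i => by fun_prop]
  refine tsum_congr fun i => ?_
  rw [lintegral_const_mul' _ _ ENNReal.ofReal_ne_top]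

end Parseval

lemma setLIntegral_ofReal_pow (m : ℕ) (c : ℝ) (hc : 0 ≤ c) :
    ∫⁻ r in Set.Ioo (0 : ℝ) 1, ENNReal.ofReal (c * r ^ m) = ENNReal.ofReal (c / (m + 1)) := by
  rw [← ofReal_integral_eq_lintegral_ofReal, ← integral_Ioc_eq_integral_Ioo,
    ← intervalIntegral.integral_of_le zero_le_one]
  · simp [div_eq_mul_inv]
  · exact (ContinuousOn.integrableOn_Icc (by fun_prop)).mono_set Set.Ioo_subset_Icc_self
  · filter_upwards [ae_restrict_mem measurableSet_Ioo] with r hr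
    have := hr.1
    positivity

lemma lintegral_radial {n : ℕ} (hn : 1 ≤ n) (d : ℕ) :
    ∫⁻ r in Set.Ioo (0 : ℝ) 1,
      ENNReal.ofReal (2 * n * r ^ (2 * n - 1) * (r ^ (2 * d) * 1)) =
      ENNReal.ofReal (n / (n + d)) := by
  have h : ∀ r : ℝ, 2 * n * r ^ (2 * n - 1) * (r ^ (2 * d) * 1) =
      (2 * n : ℝ) * r ^ (2 * n - 1 + 2 * d) := fun r => by rw [pow_add]; ring
  simp_rw [h]
  rw [setLIntegral_ofReal_pow _ _ (by positivity)]
  congr 1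
  have : (((2 * n - 1 + 2 * d : ℕ) : ℝ) + 1) = 2 * (n + d) := by
    rw [← Nat.cast_add_one, show 2 * n - 1 + 2 * d + 1 = 2 * (n + d) by omega]
    push_cast; ring
  rw [this, mul_div_mul_left _ _ two_ne_zero]

/-- The difference of the unweighted integrals in degrees d and d + 1. -/
lemma lintegral_radial_one_sub_sq {n : ℕ} (hn : 1 ≤ n) (d : ℕ) :
    ∫⁻ r in Set.Ioo (0 : ℝ) 1,
      ENNReal.ofReal (2 * n * r ^ (2 * n - 1) * (r ^ (2 * d) * (1 - r ^ 2))) =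
      ENNReal.ofReal (n / ((n + d) * (n + d + 1))) := by
  have h1 := lintegral_radial hn d
  have h2 := lintegral_radial hn (d + 1)
  have h3 : ∀ r ∈ Set.Ioo (0 : ℝ) 1, ENNReal.ofReal (2 * n * r ^ (2 * n - 1) * (r ^ (2 * d) * 1)) =
      ENNReal.ofReal (2 * n * r ^ (2 * n - 1) * (r ^ (2 * d) * (1 - r ^ 2))) +
      ENNReal.ofReal (2 * n * r ^ (2 * n - 1) * (r ^ (2 * (d + 1)) * 1)) := by
    intro r hr
    have hr0 := hr.1
    have : 0 ≤ 1 - r ^ 2 := by nlinarith [hr.1, hr.2]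
    rw [← ENNReal.ofReal_add (by positivity) (by positivity)]
    congr 1
    ring
  rw [setLIntegral_congr_fun measurableSet_Ioo h3, lintegral_add_left (by fun_prop), h2] at h1
  have hn' : (0 : ℝ) < n := by exact_mod_cast hn
  rw [ENNReal.eq_sub_of_add_eq ENNReal.ofReal_ne_top h1, ← ENNReal.ofReal_sub _ (by positivity)]
  congr 1
  push_cast
  field_simp
  ring

/-! ### Derivatives of monomials and their inner products on the sphere. -/

section Shift

variable {n : ℕ}

lemma shift_injective (p : Fin n) :
    Function.Injective fun k : Fin n → ℕ => k + Pi.single p 1 := add_left_injective _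

lemma sum_add_single (k : Fin n → ℕ) (p : Fin n) :
    ∑ i, (k + Pi.single p 1 : Fin n → ℕ) i = ∑ i, k i + 1 := by
  simp [Finset.sum_add_distrib]

lemma mono_add_single (k : Fin n → ℕ) (p : Fin n) (z : Cn n) :
    mono (k + Pi.single p 1) z = mono k z * z p := by
  simp only [mono, Pi.add_apply, pow_add, Finset.prod_mul_distrib]
  congr 1
  rw [Finset.prod_eq_single p] <;> simp +contextual

lemma prod_factorial_add_single (k : Fin n → ℕ) (p : Fin n) :
    ∏ i, (((k + Pi.single p 1 : Fin n → ℕ) i)! : ℝ) = (∏ i, ((k i)! : ℝ)) * (k p + 1) := by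
  rw [← Finset.mul_prod_erase _ _ (Finset.mem_univ p),
    ← Finset.mul_prod_erase Finset.univ (fun i => ((k i)! : ℝ)) (Finset.mem_univ p)]
  have : ∀ i ∈ Finset.univ.erase p,
      (((k + Pi.single p 1 : Fin n → ℕ) i)! : ℝ) = ((k i)! : ℝ) := fun i hi => by
    simp [Finset.ne_of_mem_erase hi]
  rw [Finset.prod_congr rfl this]
  simp [Nat.factorial_succ]
  ring

lemma exists_eq_add_single {l : Fin n → ℕ} {p : Fin n} (h : l p ≠ 0) :
    ∃ k : Fin n → ℕ, l = k + Pi.single p 1 :=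
  ⟨l - Pi.single p 1, (tsub_add_cancel_of_le (by
    intro i
    by_cases hi : i = p
    · subst hi; simpa using Nat.one_le_iff_ne_zero.2 h
    · simp [hi])).symm⟩

lemma sphereWeight_add_single (hn : 1 ≤ n) (k : Fin n → ℕ) (p : Fin n) :
    sphereWeight (k + Pi.single p 1) * (n + ((∑ i, k i : ℕ) : ℝ)) = sphereWeight k * (k p + 1) := by
  unfold sphereWeight
  rw [prod_factorial_add_single, sum_add_single, ← add_assoc, Nat.factorial_succ]
  have : ((n - 1 + ∑ i, k i + 1 : ℕ) : ℝ) = n + ((∑ i, k i : ℕ) : ℝ) := by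
    rw [← Nat.cast_add]; congr 1; omega
  rw [Nat.cast_mul, this]
  have h1 : (0 : ℝ) < n + ((∑ i, k i : ℕ) : ℝ) := by
    have : (0 : ℝ) < n := by exact_mod_cast hn
    positivity
  have h2 : ((n - 1 + ∑ i, k i)! : ℝ) ≠ 0 := by positivity
  field_simp

end Shift

/-- The partial derivative `∂_p z^l = l_p z^{l - e_p}` of a monomial. -/
noncomputable def gradMono {n : ℕ} (p : Fin n) (l : Fin n → ℕ) (z : Cn n) : ℂ :=
  l p * mono (l - Pi.single p 1) z

/-- The tangential derivative `z̄_p ∂_q z^l - z̄_q ∂_p z^l` of a monomial. -/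
noncomputable def tangMono {n : ℕ} (p q : Fin n) (l : Fin n → ℕ) (z : Cn n) : ℂ :=
  conj (z p) * gradMono q l z - conj (z q) * gradMono p l z

/-- The factor by which the kernel of exponent `β` multiplies the homogeneous part of degree `M`. -/
noncomputable def kernelMultiplier (n : ℕ) (β : ℝ) (M : ℕ) : ℝ :=
  risingFactorial β (M - 1) * ((n - 1)! : ℝ) / ((n - 1 + M)! : ℝ)

section GradMono

variable {n : ℕ}

@[fun_prop]
lemma continuous_gradMono (p : Fin n) (l : Fin n → ℕ) : Continuous (gradMono p l) := by
  unfold gradMono; fun_prop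

@[fun_prop]
lemma continuous_tangMono (p q : Fin n) (l : Fin n → ℕ) : Continuous (tangMono p q l) := by
  unfold tangMono; fun_prop

lemma gradMono_of_eq_zero {p : Fin n} {l : Fin n → ℕ} (h : l p = 0) (z : Cn n) :
    gradMono p l z = 0 := by simp [gradMono, h]

lemma gradMono_add_single (p : Fin n) (k : Fin n → ℕ) (z : Cn n) :
    gradMono p (k + Pi.single p 1) z = (k p + 1) * mono k z := by
  simp [gradMono]

/-- This makes the Cauchy-type integral a derivative: apart from a function of the degree, only the
factor k_p + 1 of ∂_p z^{k+e_p} survives. The truncated `M - 1` in `kernelMultiplier` is harmless at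
M = 0, where `gradMono` vanishes. -/
lemma kernelCoeff_mul_sphereWeight (β : ℝ) (p : Fin n) (k : Fin n → ℕ) :
    kernelCoeff β k * sphereWeight (k + Pi.single p 1) =
      kernelMultiplier n β (∑ i, (k + Pi.single p 1 : Fin n → ℕ) i) * (k p + 1) := by
  unfold kernelCoeff sphereWeight kernelMultiplier
  rw [prod_factorial_add_single, sum_add_single, Nat.add_sub_cancel]
  have h1 : ∏ i, ((k i)! : ℝ) ≠ 0 := Finset.prod_ne_zero_iff.2 fun i _ => by positivity
  field_simp

lemma gradMono_smul (p : Fin n) (l : Fin n → ℕ) (r : ℝ) (z : Cn n) :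
    gradMono p l (r • z) = (r : ℂ) ^ (∑ i, l i - 1) * gradMono p l z := by
  by_cases h : l p = 0
  · simp [gradMono_of_eq_zero h]
  · obtain ⟨k, rfl⟩ := exists_eq_add_single h
    rw [gradMono_add_single, gradMono_add_single, sum_add_single, mono_smul, Nat.add_sub_cancel]
    ring

lemma tangMono_smul (p q : Fin n) (l : Fin n → ℕ) (r : ℝ) (z : Cn n) :
    tangMono p q l (r • z) = (r : ℂ) ^ (∑ i, l i) * tangMono p q l z := by
  unfold tangMono
  rw [gradMono_smul, gradMono_smul]
  by_cases h : ∑ i, l i = 0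
  · have h0 : ∀ i, l i = 0 := fun i => by simpa using (Finset.sum_eq_zero_iff.1 h) i
    simp [gradMono_of_eq_zero (h0 _)]
  · obtain ⟨m, hm⟩ := Nat.exists_eq_succ_of_ne_zero h
    simp [hm, pow_succ]
    ring

lemma integral_gradMono_mul_conj (hn : 1 ≤ n) (p : Fin n) (l l' : Fin n → ℕ) :
    ∫ ζ : sphere (0 : Cn n) 1, gradMono p l ζ * conj (gradMono p l' ζ) ∂(sphereMeasure n) =
      if l = l' then ((l p * (n - 1 + ((∑ i, l i : ℕ) : ℝ)) * sphereWeight l : ℝ) : ℂ) else 0 := by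
  by_cases h : l p = 0
  · simp [gradMono_of_eq_zero h, h]
  by_cases h' : l' p = 0
  · have : l ≠ l' := fun e => h (e ▸ h')
    simp [gradMono_of_eq_zero h', this]
  obtain ⟨k, rfl⟩ := exists_eq_add_single h
  obtain ⟨k', rfl⟩ := exists_eq_add_single h'
  have e : ∀ ζ : sphere (0 : Cn n) 1, gradMono p (k + Pi.single p 1) (ζ : Cn n) *
      conj (gradMono p (k' + Pi.single p 1) (ζ : Cn n)) =
      ((k p + 1) * (k' p + 1)) * (mono k (ζ : Cn n) * conj (mono k' (ζ : Cn n))) := fun ζ => by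
    rw [gradMono_add_single, gradMono_add_single]
    simp
    ring
  simp_rw [e]
  rw [integral_const_mul, integral_mono_mul_conj_mono hn]
  by_cases hk : k = k'
  · subst hk
    simp only [if_true]
    have := sphereWeight_add_single hn k p
    rw [sum_add_single]
    have h2 : ((k + Pi.single p 1 : Fin n → ℕ) p : ℝ) * (n - 1 + ((∑ i, k i + 1 : ℕ) : ℝ)) *
        sphereWeight (k + Pi.single p 1) = (k p + 1) * (k p + 1) * sphereWeight k := by
      push_cast at this ⊢
      simp only [Pi.add_apply, Pi.single_eq_same]
      push_cast
      linear_combination (k p + 1 : ℝ) * this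
    rw [h2]
    push_cast
    ring
  · simp [hk]

/-- The inner products on the sphere of the functions `ζ̄_s ∂_t ζ^l`. -/
lemma integral_conj_gradMono (hn : 1 ≤ n) (s t s' t' : Fin n) (l l' : Fin n → ℕ) :
    ∫ ζ : sphere (0 : Cn n) 1, (conj ((ζ : Cn n) s) * gradMono t l ζ) *
        conj (conj ((ζ : Cn n) s') * gradMono t' l' ζ) ∂(sphereMeasure n) =
      if l + Pi.single t' 1 + Pi.single s' 1 = l' + Pi.single t 1 + Pi.single s 1 then
        ((l t * l' t' * sphereWeight (l - Pi.single t 1 + Pi.single s' 1) : ℝ) : ℂ) else 0 := by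
  by_cases h : l t = 0
  · simp [gradMono_of_eq_zero h, h]
  by_cases h' : l' t' = 0
  · simp [gradMono_of_eq_zero h', h']
  obtain ⟨k, rfl⟩ := exists_eq_add_single h
  obtain ⟨k', rfl⟩ := exists_eq_add_single h'
  have e : ∀ ζ : sphere (0 : Cn n) 1,
      (conj ((ζ : Cn n) s) * gradMono t (k + Pi.single t 1) (ζ : Cn n)) *
        conj (conj ((ζ : Cn n) s') * gradMono t' (k' + Pi.single t' 1) (ζ : Cn n)) =
      ((k t + 1) * (k' t' + 1)) * (mono (k + Pi.single s' 1) (ζ : Cn n) *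
        conj (mono (k' + Pi.single s 1) (ζ : Cn n))) := fun ζ => by
    rw [gradMono_add_single, gradMono_add_single, mono_add_single, mono_add_single]
    simp
    ring
  simp_rw [e]
  rw [integral_const_mul, integral_mono_mul_conj_mono hn]
  -- The matching condition is stated with additions only, to avoid truncated subtraction of
  -- multi-indices; cancelling e_t + e_{t'} gives equality of the two monomials.
  have hiff : (k + Pi.single t 1 + Pi.single t' 1 + Pi.single s' 1 =
      k' + Pi.single t' 1 + Pi.single t 1 + Pi.single s 1) ↔
      k + Pi.single s' 1 = k' + Pi.single s 1 := by
    constructor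
    · intro h
      have : (k + Pi.single s' 1) + (Pi.single t 1 + Pi.single t' 1) =
          (k' + Pi.single s 1) + (Pi.single t 1 + Pi.single t' 1) := by
        calc _ = k + Pi.single t 1 + Pi.single t' 1 + Pi.single s' 1 := by abel
          _ = _ := h
          _ = _ := by abel
      exact add_right_cancel this
    · intro h
      calc _ = (k + Pi.single s' 1) + (Pi.single t 1 + Pi.single t' 1) := by abel
        _ = (k' + Pi.single s 1) + (Pi.single t 1 + Pi.single t' 1) := by rw [h]
        _ = _ := by abel
  simp only [hiff]
  split_ifs with hk
  · simp
  · simp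

/-- Both weights are compared with that of l - e_t through `sphereWeight_add_single`. The outer
factor l_t covers the case where that subtraction truncates. -/
lemma mul_sphereWeight_swap (hn : 1 ≤ n) {s t : Fin n} (hst : s ≠ t) (l : Fin n → ℕ) :
    l t * (l t * sphereWeight (l - Pi.single t 1 + Pi.single s 1)) =
      l t * ((l s + 1) * sphereWeight l) := by
  by_cases h : l t = 0
  · simp [h]
  obtain ⟨k, rfl⟩ := exists_eq_add_single h
  have h1 := sphereWeight_add_single hn k t
  have h2 := sphereWeight_add_single hn k s
  have h3 : (0 : ℝ) < n + ((∑ i, k i : ℕ) : ℝ) := by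
    have : (0 : ℝ) < n := by exact_mod_cast hn
    positivity
  congr 1
  simp only [add_tsub_cancel_right, Pi.add_apply, Pi.single_eq_same, Pi.single_eq_of_ne hst]
  push_cast
  apply mul_right_cancel₀ h3.ne'
  linear_combination (k t + 1 : ℝ) * h2 - (k s + 1 : ℝ) * h1

lemma mul_sphereWeight_self (t : Fin n) (l : Fin n → ℕ) :
    l t * sphereWeight (l - Pi.single t 1 + Pi.single t 1) = l t * sphereWeight l := by
  by_cases h : l t = 0
  · simp [h]
  obtain ⟨k, rfl⟩ := exists_eq_add_single h
  simp

lemma integral_sub_sub_sub {X : Type*} [MeasurableSpace X] {μ : Measure X} {f₁ f₂ g₁ g₂ : X → ℂ}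
    (hf₁ : Integrable f₁ μ) (hf₂ : Integrable f₂ μ) (hg₁ : Integrable g₁ μ)
    (hg₂ : Integrable g₂ μ) :
    ∫ x, (f₁ x - f₂ x) - (g₁ x - g₂ x) ∂μ =
      (∫ x, f₁ x ∂μ - ∫ x, f₂ x ∂μ) - (∫ x, g₁ x ∂μ - ∫ x, g₂ x ∂μ) := by
  rw [← integral_sub hf₁ hf₂, ← integral_sub hg₁ hg₂]
  exact integral_sub (hf₁.sub hf₂) (hg₁.sub hg₂)

/-- Of the four inner products, the diagonal ones give l_q (l_p + 1) and l_p (l_q + 1) times the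
weight, the cross ones l_p l_q each with a minus sign; the quadratic terms cancel. -/
lemma integral_tangMono_mul_conj (hn : 1 ≤ n) {p q : Fin n} (hpq : p ≠ q) (l l' : Fin n → ℕ) :
    ∫ ζ : sphere (0 : Cn n) 1, tangMono p q l ζ * conj (tangMono p q l' ζ) ∂(sphereMeasure n) =
      if l = l' then (((l p + l q) * sphereWeight l : ℝ) : ℂ) else 0 := by
  have := isProbabilityMeasure_sphereMeasure hn
  have e : ∀ ζ : sphere (0 : Cn n) 1, tangMono p q l (ζ : Cn n) * conj (tangMono p q l' (ζ : Cn n)) =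
      ((conj ((ζ : Cn n) p) * gradMono q l ζ) * conj (conj ((ζ : Cn n) p) * gradMono q l' ζ) -
      (conj ((ζ : Cn n) p) * gradMono q l ζ) * conj (conj ((ζ : Cn n) q) * gradMono p l' ζ)) -
      ((conj ((ζ : Cn n) q) * gradMono p l ζ) * conj (conj ((ζ : Cn n) p) * gradMono q l' ζ) -
      (conj ((ζ : Cn n) q) * gradMono p l ζ) * conj (conj ((ζ : Cn n) q) * gradMono p l' ζ)) :=
    fun ζ => by
      simp only [tangMono, map_sub]
      ring
  have hint : ∀ s t s' t' : Fin n, Integrable (fun ζ : sphere (0 : Cn n) 1 =>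
      (conj ((ζ : Cn n) s) * gradMono t l ζ) * conj (conj ((ζ : Cn n) s') * gradMono t' l' ζ))
      (sphereMeasure n) := fun s t s' t' =>
    Continuous.integrable_of_hasCompactSupport (by fun_prop) (HasCompactSupport.of_compactSpace _)
  simp_rw [e]
  rw [integral_sub_sub_sub (hint p q p q) (hint p q q p) (hint q p p q) (hint q p q p)]
  simp only [integral_conj_gradMono hn]
  have c1 : (l + Pi.single q 1 + Pi.single p 1 = l' + Pi.single q 1 + Pi.single p 1) ↔ l = l' := by
    simp
  have c2 : (l + Pi.single p 1 + Pi.single q 1 = l' + Pi.single q 1 + Pi.single p 1) ↔ l = l' := by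
    rw [add_right_comm, c1]
  have c3 : (l + Pi.single q 1 + Pi.single p 1 = l' + Pi.single p 1 + Pi.single q 1) ↔ l = l' := by
    rw [add_right_comm l' , c1]
  have c4 : (l + Pi.single p 1 + Pi.single q 1 = l' + Pi.single p 1 + Pi.single q 1) ↔ l = l' := by
    simp
  simp only [c1, c2, c3, c4]
  split_ifs with h
  · subst h
    have e1 := mul_sphereWeight_swap hn hpq l
    have e2 := mul_sphereWeight_swap hn hpq.symm l
    have e3 := mul_sphereWeight_self q l
    have e4 := mul_sphereWeight_self p l
    rw [← Complex.ofReal_sub, ← Complex.ofReal_sub, ← Complex.ofReal_sub]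
    congr 1
    linear_combination e1 + e2 - (l p : ℝ) * e3 - (l q : ℝ) * e4
  · simp

end GradMono

/-! ### Series for the Cauchy-type and antisymmetric integrals. -/

section Series

variable {n : ℕ} {α : ℝ} {f : Cn n → ℂ} {a : (Fin n → ℕ) → ℂ}

lemma continuous_restrict_sphere (hf : ContinuousOn f (closedBall 0 1)) :
    Continuous fun ζ : sphere (0 : Cn n) 1 => f ζ :=
  hf.comp_continuous continuous_subtype_val fun ζ => sphere_subset_closedBall ζ.2

lemma integral_conj_coord_mul (hn : 1 ≤ n) (hf : ContinuousOn f (closedBall 0 1))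
    (ha : HasExpansion f a) (p : Fin n) (k : Fin n → ℕ) :
    ∫ ζ : sphere (0 : Cn n) 1, f ζ * conj ((ζ : Cn n) p) * conj (mono k ζ) ∂(sphereMeasure n) =
      a (k + Pi.single p 1) * sphereWeight (k + Pi.single p 1) := by
  rw [← integral_mul_conj_mono_of_hasExpansion hn hf ha]
  congr 1
  ext ζ
  rw [mono_add_single, map_mul]
  ring

lemma hasSum_cauchyTerm_shift (hn : 1 ≤ n) (hf : ContinuousOn f (closedBall 0 1))
    (ha : HasExpansion f a) (p : Fin n) {z : Cn n} (hz : z ∈ unitBall n) :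
    HasSum (fun k => (kernelCoeff ((n : ℝ) + α / 2 + 1) k : ℂ) * mono k z *
      (a (k + Pi.single p 1) * sphereWeight (k + Pi.single p 1))) (cauchyTerm α f p z) := by
  have hfc := continuous_restrict_sphere hf
  have := hasSum_integral_mul_kernel hn (β := (n : ℝ) + α / 2 + 1) (mem_ball_zero_iff.1 hz)
    (g := fun ζ => f ζ * conj ((ζ : Cn n) p)) (hfc.mul (by fun_prop))
  unfold cauchyTerm
  simpa only [integral_conj_coord_mul hn hf ha] using this

lemma kernelMultiplier_mul_gradMono (p : Fin n) (k : Fin n → ℕ) (z : Cn n) (β : ℝ) :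
    (kernelMultiplier n β (∑ i, (k + Pi.single p 1 : Fin n → ℕ) i) * a (k + Pi.single p 1)) *
      gradMono p (k + Pi.single p 1) z =
    (kernelCoeff β k : ℂ) * mono k z *
      (a (k + Pi.single p 1) * sphereWeight (k + Pi.single p 1)) := by
  have h : ((kernelCoeff β k * sphereWeight (k + Pi.single p 1) : ℝ) : ℂ) =
      ((kernelMultiplier n β (∑ i, (k + Pi.single p 1 : Fin n → ℕ) i) * (k p + 1) : ℝ) : ℂ) := by
    rw [kernelCoeff_mul_sphereWeight]
  rw [gradMono_add_single]
  push_cast at h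
  linear_combination (-(a (k + Pi.single p 1) * mono k z)) * h

lemma notMem_range_shift {l : Fin n → ℕ} {p : Fin n}
    (h : l ∉ Set.range fun k : Fin n → ℕ => k + Pi.single p 1) : l p = 0 := by
  by_contra hl
  obtain ⟨k, rfl⟩ := exists_eq_add_single hl
  exact h ⟨k, rfl⟩

/-- The power series of the Cauchy-type integral of `f`. -/
lemma hasSum_cauchyTerm (hn : 1 ≤ n) (hf : ContinuousOn f (closedBall 0 1))
    (ha : HasExpansion f a) (p : Fin n) {z : Cn n} (hz : z ∈ unitBall n) :
    HasSum (fun l => (kernelMultiplier n ((n : ℝ) + α / 2 + 1) (∑ i, l i) * a l) * gradMono p l z)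
      (cauchyTerm α f p z) := by
  rw [← (shift_injective p).hasSum_iff fun l hl => by
    rw [gradMono_of_eq_zero (notMem_range_shift hl), mul_zero]]
  refine (hasSum_cauchyTerm_shift hn hf ha p hz).congr_fun fun k => ?_
  exact kernelMultiplier_mul_gradMono p k z _

/-- After the shift l = k + e_p this is an ordinary power series converging in the unit ball, to
which `exists_sum_norm_le_of_summable` applies. -/
lemma exists_sum_norm_gradMono_le (hn : 1 ≤ n) (hf : ContinuousOn f (closedBall 0 1))
    (ha : HasExpansion f a) (p : Fin n) {r : ℝ} (hr : r < 1) :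
    ∃ C, ∀ z, ‖z‖ ≤ r → ∀ s : Finset (Fin n → ℕ),
      ∑ l ∈ s, ‖(kernelMultiplier n ((n : ℝ) + α / 2 + 1) (∑ i, l i) * a l) * gradMono p l z‖ ≤
        C := by
  obtain ⟨C, hC⟩ := exists_sum_norm_le_of_summable (n := n) (a := fun k =>
    (kernelCoeff ((n : ℝ) + α / 2 + 1) k : ℂ) *
      (a (k + Pi.single p 1) * sphereWeight (k + Pi.single p 1))) hr fun z hz => by
    refine (hasSum_cauchyTerm_shift (α := α) hn hf ha p hz).summable.congr fun k => ?_
    ring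
  refine ⟨C, fun z hz s => ?_⟩
  rw [← Finset.sum_preimage (fun k : Fin n → ℕ => k + Pi.single p 1) s
    (shift_injective p).injOn _ fun l _ hl => by
      rw [gradMono_of_eq_zero (notMem_range_shift hl), mul_zero, norm_zero]]
  refine (Finset.sum_congr rfl fun k _ => ?_).trans_le (hC z hz _)
  rw [kernelMultiplier_mul_gradMono]
  congr 1
  ring

lemma antisymTerm_eq (hn : 1 ≤ n) (hf : ContinuousOn f (closedBall 0 1))
    (ha : HasExpansion f a) (p q : Fin n) {z : Cn n} (hz : z ∈ unitBall n) :
    antisymTerm α f p q z =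
      conj (z p) * cauchyTerm α f q z - conj (z q) * cauchyTerm α f p z := by
  have := isProbabilityMeasure_sphereMeasure hn
  have hfc := continuous_restrict_sphere hf
  have h := hasSum_integral_mul_kernel hn (β := (n : ℝ) + α / 2 + 1) (mem_ball_zero_iff.1 hz)
    (g := fun ζ => conj (z p * (ζ : Cn n) q - z q * (ζ : Cn n) p) * f ζ)
    (Continuous.mul (by fun_prop) hfc)
  -- Linearity is checked on the expansions, where only continuous integrands on the sphere have to
  -- be split.
  refine h.unique ((((hasSum_cauchyTerm_shift hn hf ha q hz).mul_left (conj (z p))).sub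
    ((hasSum_cauchyTerm_shift hn hf ha p hz).mul_left (conj (z q)))).congr_fun fun k => ?_)
  have hint : ∀ i, Integrable (fun ζ : sphere (0 : Cn n) 1 =>
      f ζ * conj ((ζ : Cn n) i) * conj (mono k ζ)) (sphereMeasure n) := fun i =>
    Continuous.integrable_of_hasCompactSupport ((hfc.mul (by fun_prop)).mul (by fun_prop))
      (HasCompactSupport.of_compactSpace _)
  have e : ∀ ζ : sphere (0 : Cn n) 1,
      conj (z p * (ζ : Cn n) q - z q * (ζ : Cn n) p) * f ζ * conj (mono k ζ) =
      conj (z p) * (f ζ * conj ((ζ : Cn n) q) * conj (mono k ζ)) -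
      conj (z q) * (f ζ * conj ((ζ : Cn n) p) * conj (mono k ζ)) := fun ζ => by
    simp only [map_sub, map_mul]
    ring
  simp_rw [e]
  rw [integral_sub ((hint q).const_mul _) ((hint p).const_mul _), integral_const_mul,
    integral_const_mul, integral_conj_coord_mul hn hf ha, integral_conj_coord_mul hn hf ha]
  ring

lemma hasSum_antisymTerm (hn : 1 ≤ n) (hf : ContinuousOn f (closedBall 0 1))
    (ha : HasExpansion f a) (p q : Fin n) {z : Cn n} (hz : z ∈ unitBall n) :
    HasSum (fun l => (kernelMultiplier n ((n : ℝ) + α / 2 + 1) (∑ i, l i) * a l) * tangMono p q l z)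
      (antisymTerm α f p q z) := by
  rw [antisymTerm_eq hn hf ha p q hz]
  refine (((hasSum_cauchyTerm hn hf ha q hz).mul_left _).sub
    ((hasSum_cauchyTerm hn hf ha p hz).mul_left _)).congr_fun fun l => ?_
  simp only [tangMono]
  ring

lemma exists_sum_norm_tangMono_le (hn : 1 ≤ n) (hf : ContinuousOn f (closedBall 0 1))
    (ha : HasExpansion f a) (p q : Fin n) {r : ℝ} (hr : r < 1) :
    ∃ C, ∀ z, ‖z‖ ≤ r → ∀ s : Finset (Fin n → ℕ),
      ∑ l ∈ s, ‖(kernelMultiplier n ((n : ℝ) + α / 2 + 1) (∑ i, l i) * a l) * tangMono p q l z‖ ≤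
        C := by
  obtain ⟨C, hC⟩ := exists_sum_norm_gradMono_le (α := α) hn hf ha q hr
  obtain ⟨D, hD⟩ := exists_sum_norm_gradMono_le (α := α) hn hf ha p hr
  refine ⟨C + D, fun z hz s => ?_⟩
  refine le_trans ?_ (add_le_add (hC z hz s) (hD z hz s))
  rw [← Finset.sum_add_distrib]
  refine Finset.sum_le_sum fun l _ => ?_
  have hz1 : ∀ i, ‖z i‖ ≤ 1 := fun i => (PiLp.norm_apply_le z i).trans (hz.trans hr.le)
  rw [tangMono, mul_sub]
  refine (norm_sub_le _ _).trans (add_le_add ?_ ?_)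
  all_goals
    simp only [norm_mul, RCLike.norm_conj, mul_assoc]
    gcongr
    exact mul_le_of_le_one_left (norm_nonneg _) (hz1 _)

end Series

/-! ### The integrals as weighted sums of |a_l|². -/

section Integrals

variable {n : ℕ} {α : ℝ} {f : Cn n → ℂ} {a : (Fin n → ℕ) → ℂ}

lemma integral_norm_sq_eq {X : Type*} [MeasurableSpace X] {μ : Measure X} {g : X → ℂ} {c : ℝ}
    (h : ∫ x, g x * conj (g x) ∂μ = c) : ∫ x, ‖g x‖ ^ 2 ∂μ = c := by
  have : ∫ x, g x * conj (g x) ∂μ = ((∫ x, ‖g x‖ ^ 2 ∂μ : ℝ) : ℂ) := by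
    rw [← integral_complex_ofReal]
    congr 1
    ext x
    rw [Complex.mul_conj, Complex.normSq_eq_norm_sq]
  exact_mod_cast this.symm.trans h

/-- The weight 1 - ‖z‖² gives the radial factor n/((n+|l|-1)(n+|l|)), whose first denominator
cancels the factor n-1+|l| in the norm of ∂_p z^l. -/
theorem cauchyIntegral_eq_tsum (hn : 1 ≤ n) (hf : ContinuousOn f (closedBall 0 1))
    (ha : HasExpansion f a) (p : Fin n) :
    cauchyIntegral α f p = ∑' l : Fin n → ℕ, ENNReal.ofReal
      (‖kernelMultiplier n ((n : ℝ) + α / 2 + 1) (∑ i, l i) * a l‖ ^ 2 *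
        (l p * sphereWeight l * (n / (n + ((∑ i, l i : ℕ) : ℝ))))) := by
  have h := lintegral_ball_norm_sq_of_hasSum_orthogonal hn (continuous_gradMono p)
    (gradMono_smul p) (fun l l' hl => by rw [integral_gradMono_mul_conj hn, if_neg hl])
    (fun z hz => hasSum_cauchyTerm (α := α) hn hf ha p hz)
    (fun r hr => exists_sum_norm_gradMono_le hn hf ha p hr)
    (ω := fun r => 1 - r ^ 2) (by fun_prop) (fun r hr => by nlinarith [hr.1, hr.2])
  rw [cauchyIntegral, h]
  refine tsum_congr fun l => ?_
  rw [integral_norm_sq_eq ((integral_gradMono_mul_conj hn p l l).trans (if_pos rfl)),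
    lintegral_radial_one_sub_sq hn]
  by_cases hl : l p = 0
  · simp [hl]
  have hw := sphereWeight_pos l
  have hn' : (1 : ℝ) ≤ n := by exact_mod_cast hn
  obtain ⟨m, hm⟩ : ∃ m, ∑ i, l i = m + 1 := Nat.exists_eq_succ_of_ne_zero fun h0 =>
    hl (by simpa using (Finset.sum_eq_zero_iff.1 h0) p)
  rw [hm, Nat.add_sub_cancel, ← ENNReal.ofReal_mul (by
    have : (0 : ℝ) ≤ n - 1 + ((m + 1 : ℕ) : ℝ) := by push_cast; linarith
    positivity)]
  congr 1
  push_cast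
  have h1 : (n : ℝ) + m ≠ 0 := by positivity
  have h2 : (n : ℝ) + m + 1 ≠ 0 := by positivity
  have h3 : (n : ℝ) + (m + 1) ≠ 0 := by positivity
  have h4 : (n : ℝ) - 1 + (m + 1) = n + m := by ring
  rw [h4]
  field_simp
  ring

/-- For p ≠ q equality holds term by term, since l_p + l_q splits; for p = q the left side vanishes.
-/
theorem antisymIntegral_le (hn : 1 ≤ n) (hf : ContinuousOn f (closedBall 0 1))
    (ha : HasExpansion f a) (p q : Fin n) :
    antisymIntegral α f p q ≤ cauchyIntegral α f p + cauchyIntegral α f q := by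
  by_cases hpq : p = q
  · subst hpq
    have : antisymIntegral α f p p = 0 := by simp [antisymIntegral, antisymTerm]
    rw [this]
    exact zero_le
  have h := lintegral_ball_norm_sq_of_hasSum_orthogonal hn (continuous_tangMono p q)
    (tangMono_smul p q) (fun l l' hl => by rw [integral_tangMono_mul_conj hn hpq, if_neg hl])
    (fun z hz => hasSum_antisymTerm (α := α) hn hf ha p q hz)
    (fun r hr => exists_sum_norm_tangMono_le hn hf ha p q hr)
    (ω := fun _ => 1) (by fun_prop) (fun r hr => zero_le_one)
  simp only [one_mul] at h
  rw [cauchyIntegral_eq_tsum hn hf ha, cauchyIntegral_eq_tsum hn hf ha, antisymIntegral, h,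
    ← ENNReal.tsum_add]
  refine ENNReal.tsum_le_tsum fun l => le_of_eq ?_
  have hw := sphereWeight_pos l
  rw [integral_norm_sq_eq ((integral_tangMono_mul_conj hn hpq l l).trans (if_pos rfl)),
    lintegral_radial hn, ← ENNReal.ofReal_add (by positivity) (by positivity),
    ← ENNReal.ofReal_mul (by positivity)]
  congr 1
  ring

theorem sum_cauchyIntegral_eq_tsum (hn : 1 ≤ n) (hf : ContinuousOn f (closedBall 0 1))
    (ha : HasExpansion f a) :
    ∑ p, cauchyIntegral α f p = ∑' l : Fin n → ℕ, ENNReal.ofReal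
      (kernelMultiplier n ((n : ℝ) + α / 2 + 1) (∑ i, l i) ^ 2 * ((∑ i, l i : ℕ) : ℝ) *
        (n / (n + ((∑ i, l i : ℕ) : ℝ))) * (sphereWeight l * ‖a l‖ ^ 2)) := by
  simp_rw [cauchyIntegral_eq_tsum hn hf ha]
  rw [← Summable.tsum_finsetSum fun _ _ => ENNReal.summable]
  refine tsum_congr fun l => ?_
  have hw := sphereWeight_pos l
  rw [← ENNReal.ofReal_sum_of_nonneg fun p _ => by positivity]
  congr 1
  rw [norm_mul, mul_pow, Complex.norm_real, Real.norm_eq_abs, sq_abs, ← Finset.mul_sum,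
    ← Finset.sum_mul, ← Finset.sum_mul, Nat.cast_sum]
  ring

end Integrals

/-! ### Growth of the multiplier. -/

section Asymptotics

lemma exists_pos_bounds_of_tendsto {u : ℕ → ℝ} {L : ℝ} (hu : ∀ m, 0 < u m) (hL : 0 < L)
    (h : Tendsto u atTop (𝓝 L)) : ∃ c C : ℝ, 0 < c ∧ 0 < C ∧ ∀ m, c ≤ u m ∧ u m ≤ C := by
  obtain ⟨C, hC⟩ := h.bddAbove_range
  obtain ⟨D, hD⟩ := (h.inv₀ hL.ne').bddAbove_range
  have hC' : ∀ m, u m ≤ C := fun m => hC ⟨m, rfl⟩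
  have hD' : ∀ m, (u m)⁻¹ ≤ D := fun m => hD ⟨m, rfl⟩
  have hD0 : 0 < D := (inv_pos.2 (hu 0)).trans_le (hD' 0)
  exact ⟨D⁻¹, C, inv_pos.2 hD0, (hu 0).trans_le (hC' 0), fun m =>
    ⟨inv_le_of_inv_le₀ (hu m) (hD' m), hC' m⟩⟩

lemma tendsto_add_div_add (a b : ℝ) :
    Tendsto (fun m : ℕ => ((m : ℝ) + a) / (m + b)) atTop (𝓝 1) := by
  have h : Tendsto (fun m : ℕ => 1 + (a - b) / ((m : ℝ) + b)) atTop (𝓝 (1 + 0)) :=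
    tendsto_const_nhds.add (tendsto_const_nhds.div_atTop
      (tendsto_atTop_add_const_right _ _ tendsto_natCast_atTop_atTop))
  rw [add_zero] at h
  refine h.congr' ?_
  filter_upwards [(tendsto_atTop_add_const_right _ b
    tendsto_natCast_atTop_atTop).eventually_gt_atTop 0] with m hm
  have : (m : ℝ) + b ≠ 0 := hm.ne'
  field_simp
  ring

lemma gammaSeq_mul_risingFactorial {s : ℝ} (hs : 0 < s) (m : ℕ) :
    Real.GammaSeq s m * (risingFactorial s m * (s + m)) = (m : ℝ) ^ s * (m ! : ℝ) := by
  have h1 : 0 < risingFactorial s m := risingFactorial_pos hs m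
  have h2 : 0 < s + m := by positivity
  rw [Real.GammaSeq, Finset.prod_range_succ]
  change (m : ℝ) ^ s * (m ! : ℝ) / (risingFactorial s m * (s + m)) * _ = _
  field_simp

lemma factorial_mul_risingFactorial (n m : ℕ) :
    (n ! : ℝ) * risingFactorial ((n : ℝ) + 1) m = ((n + m)! : ℝ) := by
  induction m with
  | zero => simp [risingFactorial]
  | succ m ih =>
    rw [risingFactorial, Finset.prod_range_succ, ← mul_assoc, ← risingFactorial, ih, ← add_assoc,
      Nat.factorial_succ]
    push_cast
    ring

lemma kernelMultiplier_pos (n : ℕ) {β : ℝ} (hβ : 0 < β) (M : ℕ) : 0 < kernelMultiplier n β M := by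
  have := risingFactorial_pos hβ (M - 1)
  unfold kernelMultiplier
  positivity

/-- The growth of the multiplier, compared with a power of the degree. -/
lemma tendsto_kernelMultiplier {n : ℕ} (hn : 1 ≤ n) {α : ℝ} (hβ : 0 < (n : ℝ) + α / 2 + 1) :
    Tendsto (fun m : ℕ => kernelMultiplier n ((n : ℝ) + α / 2 + 1) (m + 1) / (m : ℝ) ^ (α / 2))
      atTop (𝓝 ((1 / n) * (Real.Gamma ((n : ℝ) + 1) / Real.Gamma ((n : ℝ) + α / 2 + 1)))) := by
  set β := (n : ℝ) + α / 2 + 1 with hβd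
  -- Here κ(m+1) = (1/n) (β)_m/(n+1)_m, and a quotient of rising factorials is a quotient of Euler's
  -- Gamma sequences up to the power m^{α/2} and a factor tending to 1.
  have h := ((tendsto_const_nhds (x := 1 / (n : ℝ))).mul
    ((Real.GammaSeq_tendsto_Gamma ((n : ℝ) + 1)).div (Real.GammaSeq_tendsto_Gamma β)
      (Real.Gamma_pos_of_pos hβ).ne')).mul (tendsto_add_div_add ((n : ℝ) + 1) β)
  rw [mul_one] at h
  refine h.congr' ?_
  filter_upwards [eventually_gt_atTop 0] with m hm
  have hm' : (0 : ℝ) < m := by exact_mod_cast hm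
  have hn' : (0 : ℝ) < n := by exact_mod_cast hn
  have e1 := gammaSeq_mul_risingFactorial hβ m
  have e2 := gammaSeq_mul_risingFactorial (s := (n : ℝ) + 1) (by positivity) m
  have hr1 := risingFactorial_pos hβ m
  have hr2 := risingFactorial_pos (β := (n : ℝ) + 1) (by positivity) m
  have hmβ : 0 < β + m := by positivity
  have hg1 : Real.GammaSeq β m = (m : ℝ) ^ β * (m ! : ℝ) / (risingFactorial β m * (β + m)) := by
    rw [eq_div_iff (by positivity), e1]
  have hg2 : Real.GammaSeq ((n : ℝ) + 1) m =
      (m : ℝ) ^ ((n : ℝ) + 1) * (m ! : ℝ) / (risingFactorial ((n : ℝ) + 1) m * ((n : ℝ) + 1 + m)) := by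
    rw [eq_div_iff (by positivity), e2]
  have hp : (m : ℝ) ^ β = (m : ℝ) ^ ((n : ℝ) + 1) * (m : ℝ) ^ (α / 2) := by
    rw [← Real.rpow_add hm', hβd]
    congr 1
    ring
  have hf1 : ((n - 1 + (m + 1))! : ℝ) = (n : ℝ) * ((n - 1)! : ℝ) * risingFactorial ((n : ℝ) + 1) m := by
    rw [show n - 1 + (m + 1) = n + m by omega, ← factorial_mul_risingFactorial,
      ← Nat.mul_factorial_pred (by omega : n ≠ 0)]
    push_cast
    ring
  have hx1 : (0 : ℝ) < (m : ℝ) ^ ((n : ℝ) + 1) := Real.rpow_pos_of_pos hm' _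
  have hx2 : (0 : ℝ) < (m : ℝ) ^ (α / 2) := Real.rpow_pos_of_pos hm' _
  have hy1 : (m : ℝ) + β ≠ 0 := by rw [add_comm]; exact hmβ.ne'
  have hy2 : (m : ℝ) + (n + 1) ≠ 0 := by positivity
  rw [kernelMultiplier, Nat.add_sub_cancel, hf1]
  simp only [Pi.div_apply]
  rw [hg1, hg2, hp, add_comm β, add_comm ((n : ℝ) + 1) (m : ℝ)]
  field_simp

theorem exists_kernelMultiplier_bounds {n : ℕ} (hn : 1 ≤ n) {α : ℝ}
    (hβ : 0 < (n : ℝ) + α / 2 + 1) :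
    ∃ c C : ℝ, 0 < c ∧ 0 < C ∧ ∀ M : ℕ, M ≠ 0 →
      c * ((n : ℝ) + M) ^ α ≤
        kernelMultiplier n ((n : ℝ) + α / 2 + 1) M ^ 2 * M * (n / (n + M)) ∧
      kernelMultiplier n ((n : ℝ) + α / 2 + 1) M ^ 2 * M * (n / (n + M)) ≤
        C * ((n : ℝ) + M) ^ α := by
  have hn' : (0 : ℝ) < n := by exact_mod_cast hn
  set L := (1 / n) * (Real.Gamma ((n : ℝ) + 1) / Real.Gamma ((n : ℝ) + α / 2 + 1)) with hL
  have hLpos : 0 < L := by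
    have := Real.Gamma_pos_of_pos hβ
    have := Real.Gamma_pos_of_pos (by positivity : (0 : ℝ) < (n : ℝ) + 1)
    positivity
  have hlim : Tendsto (fun m : ℕ => kernelMultiplier n ((n : ℝ) + α / 2 + 1) (m + 1) ^ 2 *
      ((m + 1 : ℕ) : ℝ) * (n / (n + ((m + 1 : ℕ) : ℝ))) / ((n : ℝ) + ((m + 1 : ℕ) : ℝ)) ^ α)
      atTop (𝓝 (L ^ 2 * 1 * n * 1 ^ α)) := by
    have h1 := (tendsto_kernelMultiplier hn hβ).pow 2
    have h2 := tendsto_add_div_add 1 ((n : ℝ) + 1)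
    have h3 := (tendsto_add_div_add 0 ((n : ℝ) + 1)).rpow_const (p := α) (Or.inl one_ne_zero)
    refine (((h1.mul h2).mul_const (n : ℝ)).mul h3).congr' ?_
    filter_upwards [eventually_gt_atTop 0] with m hm
    have hm' : (0 : ℝ) < m := by exact_mod_cast hm
    have hx : ((m : ℝ) ^ (α / 2)) ^ 2 = (m : ℝ) ^ α := by
      rw [← Real.rpow_natCast, ← Real.rpow_mul hm'.le]
      congr 1
      push_cast
      ring
    have hy : (n : ℝ) + ((m + 1 : ℕ) : ℝ) = m + (n + 1) := by push_cast; ring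
    have hz : (0 : ℝ) < (m : ℝ) ^ α := Real.rpow_pos_of_pos hm' _
    have hz' : (0 : ℝ) < ((m : ℝ) + (n + 1)) ^ α := Real.rpow_pos_of_pos (by positivity) _
    rw [div_pow, hx, add_zero, Real.div_rpow hm'.le (by positivity), hy]
    push_cast
    field_simp
  obtain ⟨c, C, hc, hC, h⟩ := exists_pos_bounds_of_tendsto (fun m => by
    have := kernelMultiplier_pos n hβ (m + 1)
    positivity) (by simp only [Real.one_rpow]; positivity) hlim
  refine ⟨c, C, hc, hC, fun M hM => ?_⟩
  obtain ⟨m, rfl⟩ := Nat.exists_eq_succ_of_ne_zero hM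
  have hpos : (0 : ℝ) < ((n : ℝ) + ((m + 1 : ℕ) : ℝ)) ^ α := Real.rpow_pos_of_pos (by positivity) _
  exact ⟨(le_div_iff₀ hpos).1 (h m).1, (div_le_iff₀ hpos).1 (h m).2⟩

end Asymptotics

/-! ### The norm equivalence. -/

lemma apply_zero_of_hasExpansion {n : ℕ} {f : Cn n → ℂ} {a : (Fin n → ℕ) → ℂ}
    (ha : HasExpansion f a) : f 0 = a 0 := by
  have h := ha 0 (by simp)
  have h0 := hasSum_single (f := fun k : Fin n → ℕ => a k * ∏ i, (0 : Cn n) i ^ k i) 0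
    fun k hk => by
      obtain ⟨i, hi⟩ := Function.ne_iff.1 hk
      rw [Finset.prod_eq_zero (Finset.mem_univ i) (by simpa using hi), mul_zero]
  simpa using h.unique h0

lemma dirichletWeight_eq {n : ℕ} (α : ℝ) (k : Fin n → ℕ) :
    dirichletWeight n α k = ((n : ℝ) + ((∑ i, k i : ℕ) : ℝ)) ^ α * sphereWeight k := rfl

/-- The norm equivalence already holds without the tangential integrals. -/
theorem exists_dirichletNormSq_bounds {n : ℕ} (hn : 1 ≤ n) {α : ℝ}
    (hβ : 0 < (n : ℝ) + α / 2 + 1) :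
    ∃ c C : ℝ≥0, 0 < c ∧ 0 < C ∧ ∀ (f : Cn n → ℂ) (a : (Fin n → ℕ) → ℂ), InBallAlgebra f →
      HasExpansion f a →
        (c : ℝ≥0∞) * dirichletNormSq n α a ≤
          ENNReal.ofReal (‖f 0‖ ^ 2) + ∑ p, cauchyIntegral α f p ∧
        ENNReal.ofReal (‖f 0‖ ^ 2) + ∑ p, cauchyIntegral α f p ≤
          (C : ℝ≥0∞) * dirichletNormSq n α a := by
  obtain ⟨c, C, hc, hC, h⟩ := exists_kernelMultiplier_bounds hn hβ
  have hn' : (0 : ℝ) < n := by exact_mod_cast hn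
  have hnα : (0 : ℝ) < (n : ℝ) ^ α := Real.rpow_pos_of_pos hn' _
  -- In degree 0 the Dirichlet weight is n^α while |f(0)|² has weight 1; this accounts for (n^α)⁻¹.
  refine ⟨(min c ((n : ℝ) ^ α)⁻¹).toNNReal, (max C ((n : ℝ) ^ α)⁻¹).toNNReal, ?_, ?_,
    fun f a hf ha => ?_⟩
  · exact Real.toNNReal_pos.2 (lt_min hc (inv_pos.2 hnα))
  · exact Real.toNNReal_pos.2 (lt_max_of_lt_left hC)
  have hsum : ENNReal.ofReal (‖f 0‖ ^ 2) + ∑ p, cauchyIntegral α f p =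
      ∑' l : Fin n → ℕ, ENNReal.ofReal (((if l = 0 then 1 else 0) +
        kernelMultiplier n ((n : ℝ) + α / 2 + 1) (∑ i, l i) ^ 2 * ((∑ i, l i : ℕ) : ℝ) *
        (n / (n + ((∑ i, l i : ℕ) : ℝ)))) * (sphereWeight l * ‖a l‖ ^ 2)) := by
    have h0 : ENNReal.ofReal (‖f 0‖ ^ 2) = ∑' l : Fin n → ℕ,
        ENNReal.ofReal ((if l = 0 then 1 else 0) * (sphereWeight l * ‖a l‖ ^ 2)) := by
      rw [tsum_eq_single 0 fun l hl => by simp [hl], apply_zero_of_hasExpansion ha]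
      have : ((n - 1)! : ℝ) ≠ 0 := by positivity
      simp [sphereWeight, this]
    rw [h0, sum_cauchyIntegral_eq_tsum hn hf.1 ha, ← ENNReal.tsum_add]
    refine tsum_congr fun l => ?_
    have hw := sphereWeight_pos l
    rw [← ENNReal.ofReal_add (by positivity) (by positivity), add_mul]
  have hterm : ∀ l : Fin n → ℕ,
      min c ((n : ℝ) ^ α)⁻¹ * ((n : ℝ) + ((∑ i, l i : ℕ) : ℝ)) ^ α ≤ (if l = 0 then 1 else 0) +
        kernelMultiplier n ((n : ℝ) + α / 2 + 1) (∑ i, l i) ^ 2 * ((∑ i, l i : ℕ) : ℝ) *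
        (n / (n + ((∑ i, l i : ℕ) : ℝ))) ∧
      (if l = 0 then 1 else 0) +
        kernelMultiplier n ((n : ℝ) + α / 2 + 1) (∑ i, l i) ^ 2 * ((∑ i, l i : ℕ) : ℝ) *
        (n / (n + ((∑ i, l i : ℕ) : ℝ))) ≤
        max C ((n : ℝ) ^ α)⁻¹ * ((n : ℝ) + ((∑ i, l i : ℕ) : ℝ)) ^ α := by
    intro l
    by_cases hl : l = 0
    · subst hl
      simp only [Pi.zero_apply, Finset.sum_const_zero, Nat.cast_zero, add_zero, if_true, mul_zero,
        zero_mul]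
      constructor
      · exact (mul_le_mul_of_nonneg_right (min_le_right _ _) hnα.le).trans_eq
          (inv_mul_cancel₀ hnα.ne')
      · exact (inv_mul_cancel₀ hnα.ne').symm.trans_le
          (mul_le_mul_of_nonneg_right (le_max_right _ _) hnα.le)
    · have hM : ∑ i, l i ≠ 0 := fun h0 => hl (funext fun i => by
        simpa using (Finset.sum_eq_zero_iff.1 h0) i)
      obtain ⟨h1, h2⟩ := h _ hM
      have hp : 0 ≤ ((n : ℝ) + ((∑ i, l i : ℕ) : ℝ)) ^ α := by positivity
      rw [if_neg hl, zero_add]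
      exact ⟨(mul_le_mul_of_nonneg_right (min_le_left _ _) hp).trans h1,
        h2.trans (mul_le_mul_of_nonneg_right (le_max_left _ _) hp)⟩
  have hmin : 0 ≤ min c ((n : ℝ) ^ α)⁻¹ := le_min hc.le (inv_pos.2 hnα).le
  have hmax : 0 ≤ max C ((n : ℝ) ^ α)⁻¹ := hC.le.trans (le_max_left _ _)
  rw [hsum, dirichletNormSq, ← ENNReal.tsum_mul_left, ← ENNReal.tsum_mul_left]
  constructor
  · refine ENNReal.tsum_le_tsum fun l => ?_
    have hw := sphereWeight_pos l
    change ENNReal.ofReal (min c ((n : ℝ) ^ α)⁻¹) * _ ≤ _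
    rw [← ENNReal.ofReal_mul hmin, dirichletWeight_eq]
    have hle := mul_le_mul_of_nonneg_right (hterm l).1
      (by positivity : 0 ≤ sphereWeight l * ‖a l‖ ^ 2)
    exact ENNReal.ofReal_le_ofReal (by linarith)
  · refine ENNReal.tsum_le_tsum fun l => ?_
    have hw := sphereWeight_pos l
    change _ ≤ ENNReal.ofReal (max C ((n : ℝ) ^ α)⁻¹) * _
    rw [← ENNReal.ofReal_mul hmax, dirichletWeight_eq]
    have hle := mul_le_mul_of_nonneg_right (hterm l).2
      (by positivity : 0 ≤ sphereWeight l * ‖a l‖ ^ 2)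
    exact ENNReal.ofReal_le_ofReal (by linarith)

theorem mainTheorem5 (n : ℕ) (hn : 1 ≤ n) (α : ℝ) (hα : 0 ≤ (n : ℝ) - 1 + α / 2) :
    (∀ f : Cn n → ℂ, InBallAlgebra f →
      (InDirichletSpace α f ↔
        (∀ p : Fin n, cauchyIntegral α f p < ∞) ∧
        (∀ p q : Fin n, antisymIntegral α f p q < ∞))) ∧
    (∃ c C : ℝ≥0, 0 < c ∧ 0 < C ∧
      ∀ (f : Cn n → ℂ) (a : (Fin n → ℕ) → ℂ), InBallAlgebra f → HasExpansion f a →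
        (c : ℝ≥0∞) * dirichletNormSq n α a ≤
            ENNReal.ofReal (‖f 0‖ ^ 2) + ∑ p, cauchyIntegral α f p +
              ∑ p, ∑ q, antisymIntegral α f p q ∧
          ENNReal.ofReal (‖f 0‖ ^ 2) + ∑ p, cauchyIntegral α f p +
              ∑ p, ∑ q, antisymIntegral α f p q ≤
            (C : ℝ≥0∞) * dirichletNormSq n α a) := by
  obtain ⟨c, C, hc, hC, h⟩ := exists_dirichletNormSq_bounds hn (α := α) (by linarith)
  -- Each I_p occurs 2n times in the double sum of I_p + I_q, whence the factor 1 + 2n.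
  refine ⟨fun f hf => ⟨?_, ?_⟩, c, C * (1 + 2 * n), hc, by positivity, fun f a hf ha => ⟨?_, ?_⟩⟩
  · rintro ⟨-, a, ha, hlt⟩
    have hfin : ∀ p, cauchyIntegral α f p < ∞ := fun p => by
      refine lt_of_le_of_lt ?_ (ENNReal.mul_lt_top (ENNReal.coe_lt_top (r := C)) hlt)
      exact (Finset.single_le_sum (f := fun p => cauchyIntegral α f p) (fun _ _ => zero_le)
        (Finset.mem_univ p)).trans (le_add_self.trans (h f a hf ha).2)
    exact ⟨hfin, fun p q => (antisymIntegral_le hn hf.1 ha p q).trans_lt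
      (ENNReal.add_lt_top.2 ⟨hfin p, hfin q⟩)⟩
  · rintro ⟨hfin, -⟩
    obtain ⟨a, ha⟩ := exists_hasExpansion hn hf.2
    refine ⟨hf.2, a, ha, ?_⟩
    have h1 : (c : ℝ≥0∞) * dirichletNormSq n α a < ∞ := (h f a hf ha).1.trans_lt
      (ENNReal.add_lt_top.2 ⟨ENNReal.ofReal_lt_top, ENNReal.sum_lt_top.2 fun p _ => hfin p⟩)
    by_contra htop
    rw [not_lt_top_iff] at htop
    rw [htop, ENNReal.mul_top (by exact_mod_cast hc.ne')] at h1
    exact lt_irrefl _ h1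
  · exact (h f a hf ha).1.trans le_self_add
  · set S := ENNReal.ofReal (‖f 0‖ ^ 2) + ∑ p, cauchyIntegral α f p with hS
    have hI : ∑ p, cauchyIntegral α f p ≤ S := le_add_self
    have hA : ∑ p, ∑ q, antisymIntegral α f p q ≤ 2 * n * S := by
      calc ∑ p, ∑ q, antisymIntegral α f p q
          ≤ ∑ p, ∑ q, (cauchyIntegral α f p + cauchyIntegral α f q) :=
            Finset.sum_le_sum fun p _ => Finset.sum_le_sum fun q _ =>
              antisymIntegral_le hn hf.1 ha p q
        _ = 2 * n * ∑ p, cauchyIntegral α f p := by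
            simp only [Finset.sum_add_distrib, Finset.sum_const, Finset.card_univ,
              Fintype.card_fin, nsmul_eq_mul, ← Finset.mul_sum]
            ring
        _ ≤ 2 * n * S := by gcongr
    calc S + ∑ p, ∑ q, antisymIntegral α f p q ≤ S + 2 * n * S := by gcongr
      _ = (1 + 2 * n) * S := by ring
      _ ≤ (1 + 2 * n) * (C * dirichletNormSq n α a) := by gcongr; exact (h f a hf ha).2
      _ = _ := by push_cast; ring
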